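/- Let $G=(\mathcal N,\mathcal E)$ be a finite conflict graph whose vertices are called links. A schedule is a set of links (identified with its $0/1$ vector); it is feasible if it is an independent set of $G$. Let $\Omega$ be the set of feasible schedules, and let the capacity region $\mathbb C$ be the set of all convex combinations of the vectors in $\Omega$. Let $h(x)=\log\log(x+e)$. Arrivals: the $0/1$ arrival vectors $A(t)=(A_v(t))_{v\in\mathcal N}$, $t\ge 1$, are i.i.d. over time, with $\mathbb E[A_v(t)]=\eta_v$ (any dependence between the links within a slot is allowed). Queues: $Q(0)\in\mathbb Z_{\ge0}^{\mathcal N}$ is arbitrary and deterministic, and $Q_v(t)=[Q_v(t-1)+A_v(t)-\sigma_v(t)]^+$ for $t\ge1$, where $\sigma(t)$ is the schedule used in slot $t$. Delayed CSMA of order $T\ge 1$ with parameter $\epsilon>0$: $\sigma(t)=0$ for $0\le t<T$. At each time $t\ge T$ a decision schedule $D(t)$ is drawn, independently of the past, from a fixed law on $\Omega$ under which every link is selected with positive probability. Each link $v\notin D(t)$ keeps its state of $T$ steps back, $\sigma_v(t)=\sigma_v(t-T)$. Each link $v\in D(t)$ with an active neighbour in $\sigma(t-T)$ sets $\sigma_v(t)=0$.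 Each other link $v\in D(t)$ independently sets $\sigma_v(t)=1$ with probability $\lambda_v/(1+\lambda_v)$ and $\sigma_v(t)=0$ otherwise, where $\lambda_v=e^{W_v(t-1)}$ and $$W_v(t)=\max\Big\{h(Q_v(t)),\ \frac{\epsilon}{2|\mathcal N|}\,h(Q_{\max}(t))\Big\},\qquad Q_{\max}(t)=\max_{v}Q_v(t).$$ Given the past, the schedule $\sigma(t)$ and the arrivals $A(t)$ are independent. Then for every $T\ge1$, every $\epsilon>0$ and every arrival rate vector $\eta\in(1-\epsilon)\mathbb C$, delayed CSMA of order $T$ with parameter $\epsilon$ satisfies $$\limsup_{K\to\infty}\frac1K\sum_{t=0}^{K-1}\mathbb E\Big[\Big(\sum_{v\in\mathcal N}h^2(Q_v(t))\Big)^{1/2}\Big]<\infty .$$ It is thus throughput optimal: for every arrival rate vector $\eta\in\rho\,\mathbb C$ with $0\le\rho<1$, this stability condition holds for all sufficiently small $\epsilon>0$. -/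

import Mathlib

open Filter MeasureTheory
open scoped ENNReal Pointwise

universe u w

noncomputable section

namespace DelayedCSMA

variable {V : Type u} [Fintype V] [DecidableEq V]

/-- A schedule is the set of active links; it is feasible if no two active links conflict. -/
def Feasible (G : SimpleGraph V) (S : Finset V) : Prop := G.IsIndepSet (S : Set V)

/-- The 0/1 vector of a schedule. -/
def scheduleVector (S : Finset V) : V → ℝ := fun v => if v ∈ S then 1 else 0

/-- The capacity region: all convex combinations of the feasible schedules. -/
def capacityRegion (G : SimpleGraph V) : Set (V → ℝ) :=
  convexHull ℝ (scheduleVector '' {S : Finset V | Feasible G S})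

/-- The rate vectors strictly inside the capacity region: `ρ C` for some `0 ≤ ρ < 1`. -/
def strictCapacityRegion (G : SimpleGraph V) : Set (V → ℝ) :=
  {η | ∃ ρ : ℝ, 0 ≤ ρ ∧ ρ < 1 ∧ η ∈ ρ • capacityRegion G}

/-- The function `h(x) = log log (x + e)`. -/
def h (x : ℝ) : ℝ := Real.log (Real.log (x + Real.exp 1))

/-- The length of the largest queue. -/
def maxQueue (Q : V → ℕ) : ℕ := Finset.univ.sup Q

/-- The link weight `max {h(Q_v), ε / (2|V|) h(Q_max)}`. -/
def weight (ε : ℝ) (Q : V → ℕ) (v : V) : ℝ :=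
  max (h (Q v)) (ε / (2 * (Fintype.card V : ℝ)) * h (maxQueue Q))

/-- The fugacity `exp (W_v)`. -/
def fugacity (ε : ℝ) (Q : V → ℕ) (v : V) : ℝ := Real.exp (weight ε Q v)

/-- The probability that link `v` passes from its state in the old schedule `x` to its state in the
new schedule `y`, given the decision schedule `D`. A selected link with no active neighbour in `x`
becomes active with probability `lam v / (1 + lam v)` and inactive otherwise; a selected link with
an active neighbour in `x` becomes inactive; a link that is not selected keeps its state. -/
def linkProb (G : SimpleGraph V) [DecidableRel G.Adj] (lam : V → ℝ) (D x y : Finset V) (v : V) :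
    ℝ :=
  if v ∈ D then
    if ∃ j ∈ x, G.Adj v j then
      if v ∈ y then 0 else 1
    else
      if v ∈ y then lam v / (1 + lam v) else 1 / (1 + lam v)
  else
    if v ∈ y ↔ v ∈ x then 1 else 0

/-- The transition probability from `x` to `y` of the (parallel) Glauber dynamics with fugacities
`lam`, when the decision schedule has law `α` and the links are updated independently. -/
def glauber (G : SimpleGraph V) [DecidableRel G.Adj] (α : PMF (Finset V)) (lam : V → ℝ)
    (x y : Finset V) : ℝ :=
  ∑ D : Finset V, (α D).toReal * ∏ v : V, linkProb G lam D x y v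

/-- The law of a decision schedule is admissible if the selected links never conflict and every
link is selected with positive probability. -/
def IsDecisionLaw (G : SimpleGraph V) (α : PMF (Finset V)) : Prop :=
  (∀ D ∈ α.support, Feasible G D) ∧ ∀ v : V, ∃ D ∈ α.support, v ∈ D

/-- The set of links with an arrival in one slot has law `β`; at link `v` there is an arrival with
probability `η v`. -/
def HasArrivalRate (β : PMF (Finset V)) (η : V → ℝ) : Prop :=
  ∀ v : V, ∑ a : Finset V, (if v ∈ a then (β a).toReal else 0) = η v

/-- The queue lengths `Q(t) = [Q(t-1) + A(t) - σ(t)]^+`, `Q(0) = q₀`, for given sample paths of the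
arrivals and of the schedules (truncated subtraction on `ℕ` is the positive part). -/
def queue (q₀ : V → ℕ) (a s : ℕ → Finset V) : ℕ → V → ℕ
  | 0 => q₀
  | t + 1 => fun v =>
      queue q₀ a s t v + (if v ∈ a (t + 1) then 1 else 0) - (if v ∈ s (t + 1) then 1 else 0)

/-- The conditional probability that delayed CSMA of order `T` uses schedule `y` at time `t + 1`,
given the arrivals `a` and the schedules `s` up to time `t`: the schedule is empty at the times
before `T`; from then on it is generated from the schedule `T` steps back by the Glauber dynamics
with the fugacities of the current queue lengths. -/
def scheduleProb (G : SimpleGraph V) [DecidableRel G.Adj] (T : ℕ) (α : PMF (Finset V)) (ε : ℝ)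
    (q₀ : V → ℕ) (a s : ℕ → Finset V) (t : ℕ) (y : Finset V) : ℝ :=
  if t + 1 < T then (if y = ∅ then 1 else 0)
  else glauber G α (fugacity ε (queue q₀ a s t)) (s (t + 1 - T)) y

/-- The event that the schedules at times `0, …, t` and the arrivals at times `1, …, t` are those
of the paths `s` and `a`. -/
def historyEvent {Ω : Type w} (A σ : ℕ → Ω → Finset V) (a s : ℕ → Finset V) (t : ℕ) : Set Ω :=
  {ω | (∀ i ≤ t, σ i ω = s i) ∧ ∀ i, 1 ≤ i → i ≤ t → A i ω = a i}

/-- `A t` (the links with an arrival at time `t ≥ 1`) and `σ t` (the schedule at time `t`) are the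
arrivals and the schedules of a network run by delayed CSMA of order `T`: given the past, the
arrivals of the next slot have law `β`, independently of the next schedule, whose conditional law
is that of the algorithm. -/
structure IsDelayedCSMA (G : SimpleGraph V) [DecidableRel G.Adj] (T : ℕ) (α β : PMF (Finset V))
    (ε : ℝ) (q₀ : V → ℕ) {Ω : Type w} [MeasurableSpace Ω] (P : Measure Ω)
    (A σ : ℕ → Ω → Finset V) : Prop where
  measurable_arrivals : ∀ t S, MeasurableSet {ω | A t ω = S}
  measurable_schedule : ∀ t S, MeasurableSet {ω | σ t ω = S}
  initial : ∀ᵐ ω ∂P, σ 0 ω = ∅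
  transition : ∀ (a s : ℕ → Finset V) (t : ℕ),
    P.real (historyEvent A σ a s (t + 1)) =
      P.real (historyEvent A σ a s t) *
        (scheduleProb G T α ε q₀ a s t (s (t + 1)) * (β (a (t + 1))).toReal)

/-- Queue stability:
`limsup_{K → ∞} (1/K) ∑_{t < K} E[(∑_v h(Q_v(t))²)^{1/2}] < ∞`, computed in `[0, ∞]`. -/
def QueueStable {Ω : Type w} [MeasurableSpace Ω] (P : Measure Ω) (Q : ℕ → Ω → V → ℕ) : Prop :=
  limsup (fun K : ℕ => (K : ℝ≥0∞)⁻¹ * ∑ t ∈ Finset.range K,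
    ∫⁻ ω, ENNReal.ofReal (Real.sqrt (∑ v : V, h (Q t ω v) ^ 2)) ∂P) atTop < ⊤

/-- Delayed CSMA of order `T` with weight parameter `ε` stabilizes the arrival rates `η`: the queues
are stable for all Bernoulli arrivals with these rates, all initial queue lengths and all
realizations of the process. -/
def Stabilizes (G : SimpleGraph V) [DecidableRel G.Adj] (T : ℕ) (α : PMF (Finset V)) (ε : ℝ)
    (η : V → ℝ) : Prop :=
  ∀ (β : PMF (Finset V)), HasArrivalRate β η → ∀ (q₀ : V → ℕ)
    (Ω : Type w) [MeasurableSpace Ω] (P : Measure Ω) [IsProbabilityMeasure P]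
    (A σ : ℕ → Ω → Finset V), IsDelayedCSMA G T α β ε q₀ P A σ →
      QueueStable P (fun t ω => queue q₀ (fun i => A i ω) (fun i => σ i ω) t)

/-- Throughput optimality: all arrival rates strictly inside the capacity region are stabilized, by
all sufficiently small values of the weight parameter. -/
def ThroughputOptimal (G : SimpleGraph V) [DecidableRel G.Adj] (T : ℕ) (α : PMF (Finset V)) :
    Prop :=
  ∀ η ∈ strictCapacityRegion G, ∃ ε₀ : ℝ, 0 < ε₀ ∧
    ∀ ε : ℝ, 0 < ε → ε ≤ ε₀ → Stabilizes.{u, w} G T α ε η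

end DelayedCSMA

end

/-! The proof is a Foster–Lyapunov argument that averages over the fast schedule dynamics with a
corrector. For frozen queues `Q`, the Glauber dynamics has a Gibbs law that nearly maximizes the
total weight: its mean weight is within `2 ^ |V|` of every feasible schedule (`le_sum_gibbs`). Let
`f Q x` be the weight of schedule `x`, and let `g Q` solve the Poisson equation of the frozen chain
for `f Q`. The corrector `g - f` then replaces the weight of the next schedule, in conditional mean,
by the Gibbs mean (`exists_corrector`).

The Lyapunov function is a discrete primitive of `h` summed over the queues, minus the corrector
evaluated at each of the last `T` schedules. In one slot this window gains `σ(t+1)` and loses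
`σ(t+1-T)`, which is exactly the schedule from which `σ(t+1)` was generated; so the delay costs
nothing but `T` copies of the corrector.

The remaining error is the change of the corrector when the queues move by at most one. It has to be
bounded, not small, because the drift `-ε/2 * h(Q_max)` beats any constant. This is where the double
logarithm enters. All fugacities are at most `log(Q_max + e)`, so the Poisson solution and its
stability constants are polynomial in `log(Q_max + e)` (`glauber_driftChain`,
`DriftChain.abs_poisson_sub_le`), whereas one slot changes the weights by less than any negative
power of it (`exists_weight_lipschitz`). The floor in the weight is essential there: a short queue
changes `h` quickly, but then the floor is the active term of the maximum. The floor costs half of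
the slack `ε` (`conditional_drift_le`). Telescoping the drift bounds the time average. For `ε > 1`
the rates are nonpositive, so there are almost surely no arrivals. -/

noncomputable section

namespace DelayedCSMA

/-! ### Poisson equations of finite chains, through the chain killed at one state. -/

section Poisson

variable {S : Type*} [Fintype S] [DecidableEq S]

/-- A stochastic kernel `P` with stationary law `μ` and a function `s` that decreases on average
by at least `κ` in each step of the chain killed at `o`. -/
structure DriftChain (P : S → S → ℝ) (μ : S → ℝ) (o : S) (s : S → ℝ) (κ : ℝ) : Prop where
  nonneg : ∀ x y, 0 ≤ P x y
  row_sum : ∀ x, ∑ y, P x y = 1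
  stat_nonneg : ∀ x, 0 ≤ μ x
  stat_sum : ∑ x, μ x = 1
  stat : ∀ y, ∑ x, μ x * P x y = μ y
  stat_pos : 0 < μ o
  pos : ∀ x, 0 < s x
  le_one : ∀ x, s x ≤ 1
  rate_pos : 0 < κ
  drift : ∀ x, ∑ y, (if y = o then 0 else P x y) * s y ≤ s x - κ

namespace DriftChain

variable {P P' : S → S → ℝ} {μ μ' : S → ℝ} {o : S} {s s' : S → ℝ} {κ κ' : ℝ}

/-- Maximum principle with `s` as comparison function: where `u / s` attains its maximum `m > 0`,
applying identity minus killed kernel to `u` gives at least `m * κ`, so `m ≤ b / κ`; then `s ≤ 1`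
bounds `u`. -/
theorem le_of_killed (H : DriftChain P μ o s κ) {u : S → ℝ} {b : ℝ} (hb : 0 ≤ b)
    (hu : ∀ x, u x - ∑ y, (if y = o then 0 else P x y) * u y ≤ b) (x : S) : u x ≤ b / κ := by
  obtain ⟨z, -, hz⟩ :=
    Finset.exists_max_image Finset.univ (fun x => u x / s x) ⟨x, Finset.mem_univ x⟩
  set m := u z / s z with hm
  have hle : ∀ y, u y ≤ m * s y := fun y => by
    have := hz y (Finset.mem_univ y)
    rwa [div_le_iff₀ (H.pos y)] at this
  have hzm : u z = m * s z := by rw [hm, div_mul_cancel₀ _ (H.pos z).ne']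
  rcases le_or_gt m 0 with h0 | h0
  · exact (hle x).trans ((mul_nonpos_of_nonpos_of_nonneg h0 (H.pos x).le).trans
      (div_nonneg hb H.rate_pos.le))
  · have h2 : ∑ y, (if y = o then 0 else P z y) * u y ≤
        m * ∑ y, (if y = o then 0 else P z y) * s y := by
      rw [Finset.mul_sum]
      refine Finset.sum_le_sum fun y _ => ?_
      have : 0 ≤ (if y = o then 0 else P z y) := by
        split_ifs
        · exact le_rfl
        · exact H.nonneg z y
      calc (if y = o then 0 else P z y) * u y ≤ (if y = o then 0 else P z y) * (m * s y) :=
            mul_le_mul_of_nonneg_left (hle y) this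
        _ = _ := by ring
    have h3 := mul_le_mul_of_nonneg_left (H.drift z) h0.le
    have h4 := hu z
    have h5 : m * κ ≤ b := by nlinarith
    have h6 : m ≤ b / κ := (le_div_iff₀ H.rate_pos).2 h5
    calc u x ≤ m * s x := hle x
      _ ≤ m * 1 := mul_le_mul_of_nonneg_left (H.le_one x) h0.le
      _ ≤ b / κ := by rw [mul_one]; exact h6

theorem abs_le_of_killed (H : DriftChain P μ o s κ) {u : S → ℝ} {b : ℝ}
    (hu : ∀ x, |u x - ∑ y, (if y = o then 0 else P x y) * u y| ≤ b) (x : S) : |u x| ≤ b / κ := by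
  have hb : 0 ≤ b := (abs_nonneg _).trans (hu x)
  refine abs_le'.2 ⟨H.le_of_killed hb (fun x => (abs_le.1 (hu x)).2) x, ?_⟩
  refine H.le_of_killed (u := fun x => -u x) hb (fun x => ?_) x
  have := (abs_le.1 (hu x)).1
  simp only [mul_neg, Finset.sum_neg_distrib]
  linarith

/-- The maximum principle makes the operator injective, hence surjective in finite dimension. -/
theorem exists_killed (H : DriftChain P μ o s κ) (f : S → ℝ) :
    ∃ u : S → ℝ, ∀ x, u x - ∑ y, (if y = o then 0 else P x y) * u y = f x := by
  let Φ : (S → ℝ) →ₗ[ℝ] (S → ℝ) :=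
    { toFun := fun u x => u x - ∑ y, (if y = o then 0 else P x y) * u y
      map_add' := fun u v => by
        ext x; simp only [Pi.add_apply, mul_add, Finset.sum_add_distrib]; ring
      map_smul' := fun r u => by
        ext x
        simp only [Pi.smul_apply, smul_eq_mul, RingHom.id_apply, mul_sub, Finset.mul_sum]
        congr 1
        exact Finset.sum_congr rfl fun y _ => by ring }
  have hinj : Function.Injective Φ := by
    rw [injective_iff_map_eq_zero]
    intro u hu
    ext x
    have : |u x| ≤ 0 / κ := H.abs_le_of_killed (fun z => by
      have : u z - ∑ y, (if y = o then 0 else P z y) * u y = 0 := congrFun hu z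
      rw [this, abs_zero]) x
    rw [zero_div] at this
    simpa using this
  obtain ⟨u, hu⟩ := (LinearMap.injective_iff_surjective.1 hinj) f
  exact ⟨u, fun x => congrFun hu x⟩

theorem stat_apply (H : DriftChain P μ o s κ) (u : S → ℝ) :
    ∑ x, μ x * ∑ y, P x y * u y = ∑ x, μ x * u x := by
  simp_rw [Finset.mul_sum]
  rw [Finset.sum_comm]
  refine Finset.sum_congr rfl fun y _ => ?_
  rw [← H.stat y, Finset.sum_mul]
  exact Finset.sum_congr rfl fun x _ => by ring

theorem killed_sum_eq {u : S → ℝ} (x : S) :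
    ∑ y, (if y = o then 0 else P x y) * u y = ∑ y, P x y * u y - P x o * u o := by
  rw [← Finset.sum_erase_add _ _ (Finset.mem_univ o),
    ← Finset.sum_erase_add _ (fun y => P x y * u y) (Finset.mem_univ o)]
  simp only [if_true, zero_mul, add_zero, add_sub_cancel_right]
  refine Finset.sum_congr rfl fun y hy => ?_
  rw [if_neg (Finset.ne_of_mem_erase hy)]

/-- The Poisson equation has a solution that vanishes at `o`. -/
theorem exists_poisson (H : DriftChain P μ o s κ) (f : S → ℝ) :
    ∃ g : S → ℝ, g o = 0 ∧ ∀ x, g x - ∑ y, P x y * g y = f x - ∑ y, μ y * f y := by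
  obtain ⟨g, hg⟩ := H.exists_killed (fun x => f x - ∑ y, μ y * f y)
  have h1 : ∀ x, g x - ∑ y, P x y * g y = f x - ∑ y, μ y * f y - P x o * g o := fun x => by
    rw [← hg x, killed_sum_eq]; ring
  -- Integrating the killed equation against `μ` leaves only `μ o * g o = 0`; so `g o = 0`, and
  -- killing at `o` makes no difference to `g`.
  have h2 : ∑ x, μ x * (g x - ∑ y, P x y * g y) = 0 := by
    simp_rw [mul_sub]
    rw [Finset.sum_sub_distrib, H.stat_apply, sub_self]
  have h3 : ∑ x, μ x * (f x - ∑ y, μ y * f y - P x o * g o) = - (μ o * g o) := by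
    simp_rw [mul_sub]
    rw [Finset.sum_sub_distrib, Finset.sum_sub_distrib, ← Finset.sum_mul, H.stat_sum, one_mul,
      sub_self, zero_sub, ← H.stat o, Finset.sum_mul]
    simp_rw [mul_assoc]
  simp_rw [h1] at h2
  have h4 : g o = 0 := by
    rw [h2] at h3
    have := H.stat_pos.ne'
    have h5 : μ o * g o = 0 := by linarith
    exact (mul_eq_zero.1 h5).resolve_left this
  exact ⟨g, h4, fun x => by rw [h1 x, h4]; ring⟩

theorem abs_poisson_le (H : DriftChain P μ o s κ) {f g : S → ℝ} {c b : ℝ} (h0 : g o = 0)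
    (hg : ∀ x, g x - ∑ y, P x y * g y = f x - c) (hb : ∀ x, |f x - c| ≤ b) (x : S) :
    |g x| ≤ b / κ := by
  refine H.abs_le_of_killed (fun x => ?_) x
  rw [killed_sum_eq, h0, mul_zero, sub_zero, hg]
  exact hb x

theorem abs_stat_le (H : DriftChain P μ o s κ) {u : S → ℝ} {b : ℝ} (hb : ∀ x, |u x| ≤ b) :
    |∑ x, μ x * u x| ≤ b := by
  calc |∑ x, μ x * u x| ≤ ∑ x, |μ x * u x| := Finset.abs_sum_le_sum_abs _ _
    _ ≤ ∑ x, μ x * b := Finset.sum_le_sum fun x _ => by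
        rw [abs_mul, abs_of_nonneg (H.stat_nonneg x)]
        exact mul_le_mul_of_nonneg_left (hb x) (H.stat_nonneg x)
    _ = b := by rw [← Finset.sum_mul, H.stat_sum, one_mul]

/-- Lipschitz dependence of the solution of the Poisson equation on the chain and the function. -/
theorem abs_poisson_sub_le (H' : DriftChain P' μ' o s' κ')
    {f f' g g' : S → ℝ} {a d G : ℝ} (h0 : g o = 0) (h0' : g' o = 0)
    (hg : ∀ x, g x - ∑ y, P x y * g y = f x - ∑ y, μ y * f y)
    (hg' : ∀ x, g' x - ∑ y, P' x y * g' y = f' x - ∑ y, μ' y * f' y)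
    (hf : ∀ x, |f' x - f x| ≤ a) (hP : ∀ x, ∑ y, |P' x y - P x y| ≤ d) (hG : ∀ x, |g x| ≤ G)
    (x : S) : |g' x - g x| ≤ 2 * (a + d * G) / κ' := by
  have hG0 : 0 ≤ G := (abs_nonneg _).trans (hG x)
  have e : ∀ x, |f' x - f x + ∑ y, (P' x y - P x y) * g y| ≤ a + d * G := fun x => by
    refine (abs_add_le _ _).trans (add_le_add (hf x) ?_)
    calc |∑ y, (P' x y - P x y) * g y| ≤ ∑ y, |(P' x y - P x y) * g y| :=
          Finset.abs_sum_le_sum_abs _ _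
      _ ≤ ∑ y, |P' x y - P x y| * G := Finset.sum_le_sum fun y _ => by
          rw [abs_mul]; exact mul_le_mul_of_nonneg_left (hG y) (abs_nonneg _)
      _ ≤ d * G := by rw [← Finset.sum_mul]; exact mul_le_mul_of_nonneg_right (hP x) hG0
  -- The difference solves a Poisson equation for `P'` alone, with source `f' - f + (P' - P) g`. Its
  -- centring constant is found by integrating against `μ'`, so the two stationary laws are never
  -- compared directly.
  have hu : ∀ x, (g' x - g x) - ∑ y, P' x y * (g' y - g y) =
      (f' x - f x + ∑ y, (P' x y - P x y) * g y) -
        (∑ y, μ' y * f' y - ∑ y, μ y * f y) := fun x => by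
    have h1 := hg x
    have h2 := hg' x
    simp only [mul_sub, sub_mul, Finset.sum_sub_distrib]
    linarith
  have hc : ∑ y, μ' y * f' y - ∑ y, μ y * f y =
      ∑ x, μ' x * (f' x - f x + ∑ y, (P' x y - P x y) * g y) := by
    have h1 : ∑ x, μ' x * ((g' x - g x) - ∑ y, P' x y * (g' y - g y)) = 0 := by
      simp_rw [mul_sub (μ' _) (g' _ - g _)]
      rw [Finset.sum_sub_distrib, H'.stat_apply, sub_self]
    simp_rw [hu] at h1
    simp_rw [mul_sub (μ' _) (_ + _)] at h1
    rw [Finset.sum_sub_distrib, ← Finset.sum_mul, H'.stat_sum] at h1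
    linarith
  have hc' : |∑ y, μ' y * f' y - ∑ y, μ y * f y| ≤ a + d * G := by
    rw [hc]; exact H'.abs_stat_le e
  refine H'.abs_le_of_killed (u := fun x => g' x - g x) (fun x => ?_) x
  rw [killed_sum_eq, h0, h0', sub_self, mul_zero, sub_zero, hu]
  have h1 := abs_le.1 (e x)
  have h2 := abs_le.1 hc'
  exact abs_le.2 ⟨by linarith, by linarith⟩

end DriftChain

end Poisson

/-! ### Glauber dynamics: stationary law, return to the empty schedule, dependence on the
fugacities. -/

section Glauber

set_option linter.unusedSectionVars false

variable {V : Type u} [Fintype V] [DecidableEq V] {G : SimpleGraph V} [DecidableRel G.Adj]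
  {lam lam' : V → ℝ} {α : PMF (Finset V)}

theorem pmf_sum_toReal {X : Type*} [Fintype X] (p : PMF X) : ∑ x, (p x).toReal = 1 := by
  rw [← ENNReal.toReal_sum (fun x _ => p.apply_ne_top x), ← tsum_fintype (L := .unconditional _),
    p.tsum_coe, ENNReal.toReal_one]

theorem pmf_toReal_le_one {X : Type*} (p : PMF X) (x : X) : (p x).toReal ≤ 1 :=
  ENNReal.toReal_le_of_le_ofReal zero_le_one (by simpa using p.coe_le_one x)

theorem sum_prod_ite_mem (f g : V → ℝ) :
    ∑ y : Finset V, ∏ v, (if v ∈ y then f v else g v) = ∏ v, (f v + g v) := by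
  rw [Finset.prod_add, Finset.powerset_univ]
  refine Finset.sum_congr rfl fun y _ => ?_
  rw [Finset.prod_ite]
  congr 2
  · ext v; simp
  · ext v; simp

theorem linkProb_nonneg (h0 : ∀ v, 0 ≤ lam v) (D x y : Finset V) (v : V) :
    0 ≤ linkProb G lam D x y v := by
  have := h0 v
  unfold linkProb
  split_ifs <;> positivity

theorem linkProb_le_one (h0 : ∀ v, 0 ≤ lam v) (D x y : Finset V) (v : V) :
    linkProb G lam D x y v ≤ 1 := by
  have := h0 v
  unfold linkProb
  split_ifs
  · exact zero_le_one
  · exact le_rfl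
  · rw [div_le_one (by positivity)]; linarith
  · rw [div_le_one (by positivity)]; linarith
  · exact le_rfl
  · exact zero_le_one

theorem sum_prod_linkProb (h0 : ∀ v, 0 ≤ lam v) (D x : Finset V) :
    ∑ y, ∏ v, linkProb G lam D x y v = 1 := by
  let f : V → ℝ := fun v => if v ∈ D then if ∃ j ∈ x, G.Adj v j then 0 else lam v / (1 + lam v)
    else if v ∈ x then 1 else 0
  let g : V → ℝ := fun v => if v ∈ D then if ∃ j ∈ x, G.Adj v j then 1 else 1 / (1 + lam v)
    else if v ∈ x then 0 else 1
  have h1 : ∀ y v, linkProb G lam D x y v = if v ∈ y then f v else g v := fun y v => by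
    unfold linkProb f g
    split_ifs <;> simp_all
  simp_rw [h1]
  rw [sum_prod_ite_mem]
  refine Finset.prod_eq_one fun v _ => ?_
  have : 1 + lam v ≠ 0 := by have := h0 v; positivity
  unfold f g
  split_ifs
  · simp
  · field_simp
    ring
  · simp
  · simp

theorem glauber_nonneg (h0 : ∀ v, 0 ≤ lam v) (x y : Finset V) : 0 ≤ glauber G α lam x y :=
  Finset.sum_nonneg fun D _ => mul_nonneg ENNReal.toReal_nonneg
    (Finset.prod_nonneg fun v _ => linkProb_nonneg h0 D x y v)

theorem glauber_row_sum (h0 : ∀ v, 0 ≤ lam v) (x : Finset V) : ∑ y, glauber G α lam x y = 1 := by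
  unfold glauber
  rw [Finset.sum_comm]
  simp_rw [← Finset.mul_sum, sum_prod_linkProb h0, mul_one]
  exact pmf_sum_toReal α

open Classical in
/-- The weight of a schedule in the stationary law of the Glauber dynamics. -/
def gibbsWeight (G : SimpleGraph V) (lam : V → ℝ) (x : Finset V) : ℝ :=
  if Feasible G x then ∏ v ∈ x, lam v else 0

/-- The stationary law of the Glauber dynamics. -/
def gibbs (G : SimpleGraph V) (lam : V → ℝ) (x : Finset V) : ℝ :=
  gibbsWeight G lam x / ∑ z, gibbsWeight G lam z

theorem feasible_empty (G : SimpleGraph V) : Feasible G ∅ := by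
  simp [Feasible, SimpleGraph.IsIndepSet]

theorem Feasible.not_adj {x : Finset V} (hx : Feasible G x) {u v : V} (hu : u ∈ x) (hv : v ∈ x) :
    ¬ G.Adj u v := fun h =>
  hx (Finset.mem_coe.2 hu) (Finset.mem_coe.2 hv) h.ne h

theorem gibbsWeight_nonneg (h0 : ∀ v, 0 < lam v) (x : Finset V) : 0 ≤ gibbsWeight G lam x := by
  unfold gibbsWeight
  split_ifs
  · exact Finset.prod_nonneg fun v _ => (h0 v).le
  · exact le_rfl

theorem gibbsWeight_empty : gibbsWeight G lam ∅ = 1 := by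
  simp [gibbsWeight, feasible_empty]

theorem sum_gibbsWeight_pos (h0 : ∀ v, 0 < lam v) : 0 < ∑ z, gibbsWeight G lam z :=
  Finset.sum_pos' (fun z _ => gibbsWeight_nonneg h0 z)
    ⟨∅, Finset.mem_univ _, by rw [gibbsWeight_empty]; exact one_pos⟩

/-- For a conflicting pair in `y`, at most one end lies in `D`. If one does, the other keeps its
state and either blocks it or is wrongly inactive in `x`; if neither does, both would have to be
active in `x`. -/
theorem prod_linkProb_eq_zero_of_infeasible {D x y : Finset V} (hD : Feasible G D)
    (hx : Feasible G x) (hy : ¬ Feasible G y) : ∏ v, linkProb G lam D x y v = 0 := by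
  have : ∃ a ∈ y, ∃ b ∈ y, G.Adj a b := by
    by_contra! hn
    exact hy fun a ha b hb _ => hn a ha b hb
  obtain ⟨a, ha, b, hb, hab⟩ := this
  have key : ∀ a ∈ y, ∀ b ∈ y, G.Adj a b → a ∈ D → ∏ v, linkProb G lam D x y v = 0 := by
    intro a ha b hb hab haD
    have hbD : b ∉ D := fun h => hD.not_adj haD h hab
    by_cases hbx : b ∈ x
    · refine Finset.prod_eq_zero (Finset.mem_univ a) ?_
      rw [linkProb, if_pos haD, if_pos ⟨b, hbx, hab⟩, if_pos ha]
    · refine Finset.prod_eq_zero (Finset.mem_univ b) ?_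
      rw [linkProb, if_neg hbD, if_neg (by simp [hb, hbx])]
  by_cases haD : a ∈ D
  · exact key a ha b hb hab haD
  by_cases hbD : b ∈ D
  · exact key b hb a ha hab.symm hbD
  by_cases hax : a ∈ x
  · have hbx : b ∉ x := fun h => hx.not_adj hax h hab
    refine Finset.prod_eq_zero (Finset.mem_univ b) ?_
    rw [linkProb, if_neg hbD, if_neg (by simp [hb, hbx])]
  · refine Finset.prod_eq_zero (Finset.mem_univ a) ?_
    rw [linkProb, if_neg haD, if_neg (by simp [ha, hax])]

/-- Detailed balance holds link by link for fixed `D`. Unless both sides vanish, `x` and `y` agree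
off `D`; the neighbours of a link of `D` lie off `D`, so the link is blocked in `x` exactly when it
is blocked in `y`. -/
theorem prod_linkProb_balance {D x y : Finset V} (hD : Feasible G D)
    (hx : Feasible G x) (hy : Feasible G y) :
    (∏ v ∈ x, lam v) * ∏ v, linkProb G lam D x y v =
      (∏ v ∈ y, lam v) * ∏ v, linkProb G lam D y x v := by
  by_cases hag : ∀ v, v ∉ D → (v ∈ y ↔ v ∈ x)
  · have e : ∀ z : Finset V, ∏ v ∈ z, lam v = ∏ v, (if v ∈ z then lam v else 1) := fun z => by
      simp
    rw [e x, e y, ← Finset.prod_mul_distrib, ← Finset.prod_mul_distrib]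
    refine Finset.prod_congr rfl fun v _ => ?_
    by_cases hv : v ∈ D
    · have hnb : (∃ j ∈ x, G.Adj v j) ↔ (∃ j ∈ y, G.Adj v j) := by
        constructor
        · rintro ⟨j, hj, hvj⟩
          exact ⟨j, (hag j fun h => hD.not_adj hv h hvj).2 hj, hvj⟩
        · rintro ⟨j, hj, hvj⟩
          exact ⟨j, (hag j fun h => hD.not_adj hv h hvj).1 hj, hvj⟩
      by_cases hn : ∃ j ∈ x, G.Adj v j
      · have hn' := hnb.1 hn
        have hvx : v ∉ x := by
          obtain ⟨j, hj, hvj⟩ := hn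
          exact fun h => hx.not_adj h hj hvj
        have hvy : v ∉ y := by
          obtain ⟨j, hj, hvj⟩ := hn'
          exact fun h => hy.not_adj h hj hvj
        simp [linkProb, hv, hn, hn', hvx, hvy]
      · have hn' : ¬ ∃ j ∈ y, G.Adj v j := fun h => hn (hnb.2 h)
        rw [linkProb, linkProb, if_pos hv, if_pos hv, if_neg hn, if_neg hn']
        split_ifs <;> ring
    · have h1 := hag v hv
      rw [linkProb, linkProb, if_neg hv, if_neg hv]
      simp [h1]
  · push Not at hag
    obtain ⟨v, hv, hne⟩ := hag
    have h1 : ¬ (v ∈ y ↔ v ∈ x) := by tauto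
    have h2 : ¬ (v ∈ x ↔ v ∈ y) := by tauto
    rw [Finset.prod_eq_zero (f := fun v => linkProb G lam D x y v) (Finset.mem_univ v)
        (by rw [linkProb, if_neg hv, if_neg h1]),
      Finset.prod_eq_zero (f := fun v => linkProb G lam D y x v) (Finset.mem_univ v)
        (by rw [linkProb, if_neg hv, if_neg h2])]
    simp

theorem gibbsWeight_balance (hα : IsDecisionLaw G α) (x y : Finset V) :
    gibbsWeight G lam x * glauber G α lam x y = gibbsWeight G lam y * glauber G α lam y x := by
  unfold glauber
  rw [Finset.mul_sum, Finset.mul_sum]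
  refine Finset.sum_congr rfl fun D _ => ?_
  by_cases hD : D ∈ α.support
  · have hD := hα.1 D hD
    by_cases hx : Feasible G x <;> by_cases hy : Feasible G y
    · have := prod_linkProb_balance (lam := lam) hD hx hy
      simp only [gibbsWeight, if_pos hx, if_pos hy]
      linear_combination (α D).toReal * this
    · simp [gibbsWeight, hy, prod_linkProb_eq_zero_of_infeasible hD hx hy]
    · simp [gibbsWeight, hx, prod_linkProb_eq_zero_of_infeasible hD hy hx]
    · simp [gibbsWeight, hx, hy]
  · have : α D = 0 := by simpa [PMF.mem_support_iff] using hD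
    simp [this]

theorem gibbs_stat (hα : IsDecisionLaw G α) (h0 : ∀ v, 0 < lam v) (y : Finset V) :
    ∑ x, gibbs G lam x * glauber G α lam x y = gibbs G lam y := by
  have : ∀ x, gibbs G lam x * glauber G α lam x y = gibbs G lam y * glauber G α lam y x :=
    fun x => by
      have := gibbsWeight_balance (lam := lam) hα x y
      unfold gibbs
      linear_combination (∑ z, gibbsWeight G lam z)⁻¹ * this
  simp_rw [this]
  rw [← Finset.mul_sum, glauber_row_sum fun v => (h0 v).le, mul_one]

/-- One way to reach `x \ D` is to draw `D` and have every link of `D` switch off; each does so with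
probability at least `(1 + Λ)⁻¹`, blocked or not. -/
theorem le_glauber_sdiff (h0 : ∀ v, 0 ≤ lam v) {Λ : ℝ} (hΛ : ∀ v, lam v ≤ Λ) (h0Λ : 0 ≤ Λ)
    (D x : Finset V) :
    (α D).toReal * ((1 + Λ)⁻¹) ^ Fintype.card V ≤ glauber G α lam x (x \ D) := by
  unfold glauber
  refine le_trans ?_ (Finset.single_le_sum (f := fun D' => (α D').toReal *
    ∏ v, linkProb G lam D' x (x \ D) v) (fun D' _ => mul_nonneg ENNReal.toReal_nonneg
      (Finset.prod_nonneg fun v _ => linkProb_nonneg h0 D' x _ v)) (Finset.mem_univ D))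
  refine mul_le_mul_of_nonneg_left ?_ ENNReal.toReal_nonneg
  rw [← Finset.card_univ, ← Finset.prod_const]
  refine Finset.prod_le_prod (fun v _ => by positivity) fun v _ => ?_
  have h1 : (1 + Λ)⁻¹ ≤ 1 := inv_le_one_of_one_le₀ (by linarith)
  have h2 : (1 + Λ)⁻¹ ≤ 1 / (1 + lam v) := by
    rw [one_div]
    exact inv_anti₀ (by have := h0 v; linarith) (by have := hΛ v; linarith)
  unfold linkProb
  by_cases hv : v ∈ D
  · simp only [hv, if_true, Finset.mem_sdiff, not_true, and_false, if_false]
    split_ifs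
    · exact h1
    · exact h2
  · simp [hv, h1]

/-- With all fugacities in `[0, Λ]`, the Glauber dynamics killed at the empty schedule has a drift
function. -/
theorem glauber_driftChain [Nonempty V] (hα : IsDecisionLaw G α) (h0 : ∀ v, 0 < lam v) {Λ : ℝ}
    (hΛ : ∀ v, lam v ≤ Λ) {a : ℝ} (ha0 : 0 < a) (ha : ∀ v, ∃ D, v ∈ D ∧ a ≤ (α D).toReal) :
    DriftChain (glauber G α lam) (gibbs G lam) ∅
      (fun x => 1 - (a * ((1 + Λ)⁻¹) ^ Fintype.card V / 2) ^ (x.card + 1))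
      ((a * ((1 + Λ)⁻¹) ^ Fintype.card V / 2) ^ (Fintype.card V + 1)) := by
  have h0' : ∀ v, 0 ≤ lam v := fun v => (h0 v).le
  obtain ⟨v₀⟩ := ‹Nonempty V›
  have h0Λ : 0 ≤ Λ := (h0' v₀).trans (hΛ v₀)
  -- Half the lower bound for the chance to drop a given link: of the resulting gain `2 * r ^
  -- (x.card + 1)`, one half is the defect `1 - s x`, the other is the drift.
  set r := a * ((1 + Λ)⁻¹) ^ Fintype.card V / 2 with hr
  have hr0 : 0 < r := by positivity
  have ha1 : a ≤ 1 := by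
    obtain ⟨D, -, hD⟩ := ha v₀
    exact hD.trans (pmf_toReal_le_one α D)
  have hr1 : r ≤ 1 / 2 := by
    have : ((1 + Λ)⁻¹) ^ Fintype.card V ≤ 1 :=
      pow_le_one₀ (by positivity) (inv_le_one_of_one_le₀ (by linarith))
    have := mul_le_one₀ ha1 (by positivity) this
    rw [hr]; linarith
  have hr1' : r ≤ 1 := by linarith
  have hZ := sum_gibbsWeight_pos (G := G) h0
  refine ⟨glauber_nonneg h0', glauber_row_sum h0', fun x => ?_, ?_, gibbs_stat hα h0, ?_,
    fun x => ?_, fun x => ?_, pow_pos hr0 _, fun x => ?_⟩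
  · exact div_nonneg (gibbsWeight_nonneg h0 x) hZ.le
  · unfold gibbs
    rw [← Finset.sum_div, div_self hZ.ne']
  · exact div_pos (by rw [gibbsWeight_empty]; exact one_pos) hZ
  · have : r ^ (x.card + 1) < 1 := pow_lt_one₀ hr0.le (by linarith) (by simp)
    linarith
  · have : 0 ≤ r ^ (x.card + 1) := by positivity
    linarith
  -- A decision schedule meeting `x` leads to a strictly smaller schedule `z`, where `s` is smaller;
  -- if `z` is empty, the whole mass is killed. Feasibility of `x` plays no role, so infeasible
  -- states are covered too.
  · obtain ⟨D, hD, hDx⟩ : ∃ D, a ≤ (α D).toReal ∧ (x ≠ ∅ → (x \ D).card + 1 ≤ x.card) := by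
      rcases x.eq_empty_or_nonempty with rfl | ⟨v, hv⟩
      · obtain ⟨D, -, hD⟩ := ha v₀
        exact ⟨D, hD, fun h => (h rfl).elim⟩
      · obtain ⟨D, hvD, hD⟩ := ha v
        refine ⟨D, hD, fun _ => Finset.card_lt_card ?_⟩
        exact Finset.ssubset_iff_subset_ne.2 ⟨Finset.sdiff_subset, fun h => by
          have := h ▸ hv
          simp [hvD] at this⟩
    set z := x \ D with hz
    have hp : 2 * r ≤ glauber G α lam x z := by
      refine le_trans ?_ (le_glauber_sdiff h0' hΛ h0Λ D x)
      rw [hr]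
      have : 0 ≤ ((1 + Λ)⁻¹) ^ Fintype.card V := by positivity
      nlinarith
    have hrk : r ^ x.card ≤ 1 := pow_le_one₀ hr0.le hr1'
    have h1 : ∀ y, (if y = ∅ then 0 else glauber G α lam x y) * (1 - r ^ (y.card + 1)) ≤
        glauber G α lam x y - if y = z then glauber G α lam x z * r ^ x.card else 0 := by
      intro y
      have hg := glauber_nonneg (G := G) (α := α) h0' x y
      have hry : 0 ≤ r ^ (y.card + 1) := by positivity
      by_cases hyz : y = z
      · rw [if_pos hyz]
        rw [hyz] at hg hry ⊢
        by_cases hye : z = ∅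
        · rw [if_pos hye]; nlinarith
        · rw [if_neg hye]
          have : r ^ x.card ≤ r ^ (z.card + 1) := by
            refine pow_le_pow_of_le_one hr0.le hr1' (hDx fun hx => hye ?_)
            rw [hz, hx, Finset.empty_sdiff]
          nlinarith
      · rw [if_neg hyz, sub_zero]
        split_ifs <;> nlinarith
    refine (Finset.sum_le_sum fun y _ => h1 y).trans ?_
    rw [Finset.sum_sub_distrib, glauber_row_sum h0', Finset.sum_ite_eq' Finset.univ z,
      if_pos (Finset.mem_univ z)]
    have h2 : r ^ (Fintype.card V + 1) ≤ r ^ (x.card + 1) :=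
      pow_le_pow_of_le_one hr0.le hr1' (by gcongr; exact Finset.card_le_univ x)
    have h3 : 2 * r * r ^ x.card ≤ glauber G α lam x z * r ^ x.card :=
      mul_le_mul_of_nonneg_right hp (by positivity)
    have h4 : r ^ (x.card + 1) = r * r ^ x.card := by ring
    linarith

/-- The Gibbs variational bound. -/
theorem le_sum_gibbs (W : V → ℝ) {x : Finset V} (hx : Feasible G x) :
    ∑ v ∈ x, W v - 2 ^ Fintype.card V ≤
      ∑ y, gibbs G (fun v => Real.exp (W v)) y * ∑ v ∈ y, W v := by
  set lam : V → ℝ := fun v => Real.exp (W v)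
  have h0 : ∀ v, 0 < lam v := fun v => Real.exp_pos _
  have hZ := sum_gibbsWeight_pos (G := G) h0
  have hw : ∀ y, Feasible G y → gibbsWeight G lam y = Real.exp (∑ v ∈ y, W v) := fun y hy => by
    rw [gibbsWeight, if_pos hy, Real.exp_sum]
  have hxZ : Real.exp (∑ v ∈ x, W v) ≤ ∑ z, gibbsWeight G lam z := by
    rw [← hw x hx]
    exact Finset.single_le_sum (fun z _ => gibbsWeight_nonneg h0 z) (Finset.mem_univ x)
  -- From `u ≤ exp u`: each `y` contributes a deficit of at most `exp (W x) ≤ Z`. Summing over the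
  -- `2 ^ |V|` subsets and dividing by `Z` gives the constant.
  have h1 : ∀ y, gibbsWeight G lam y * (∑ v ∈ x, W v - ∑ v ∈ y, W v) ≤
      ∑ z, gibbsWeight G lam z := fun y => by
    by_cases hy : Feasible G y
    · refine le_trans ?_ hxZ
      rw [hw y hy]
      have h2 := Real.add_one_le_exp (∑ v ∈ x, W v - ∑ v ∈ y, W v)
      calc _ ≤ Real.exp (∑ v ∈ y, W v) * Real.exp (∑ v ∈ x, W v - ∑ v ∈ y, W v) :=
            mul_le_mul_of_nonneg_left (by linarith) (Real.exp_pos _).le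
        _ = _ := by rw [← Real.exp_add]; congr 1; ring
    · rw [gibbsWeight, if_neg hy, zero_mul]; exact hZ.le
  have h3 := Finset.sum_le_sum fun y (_ : y ∈ Finset.univ) => h1 y
  rw [Finset.sum_const, Finset.card_univ, Fintype.card_finset, nsmul_eq_mul] at h3
  simp_rw [mul_sub] at h3
  rw [Finset.sum_sub_distrib, ← Finset.sum_mul] at h3
  have h4 : ∑ y, gibbs G lam y * ∑ v ∈ y, W v =
      (∑ y, gibbsWeight G lam y * ∑ v ∈ y, W v) / ∑ z, gibbsWeight G lam z := by
    rw [Finset.sum_div]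
    exact Finset.sum_congr rfl fun y _ => by unfold gibbs; ring
  rw [h4, le_div_iff₀ hZ]
  push_cast at h3
  linarith

theorem abs_prod_sub_prod_le {ι : Type*} (t : Finset ι) {f g : ι → ℝ} {d : ℝ}
    (hf0 : ∀ i, 0 ≤ f i) (hf : ∀ i, f i ≤ 1) (hg0 : ∀ i, 0 ≤ g i) (hg : ∀ i, g i ≤ 1)
    (hd : ∀ i, |f i - g i| ≤ d) : |∏ i ∈ t, f i - ∏ i ∈ t, g i| ≤ t.card * d := by
  classical
  induction t using Finset.induction_on with
  | empty => simp
  | insert i t hi ih =>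
    rw [Finset.prod_insert hi, Finset.prod_insert hi, Finset.card_insert_of_notMem hi]
    have e : f i * ∏ j ∈ t, f j - g i * ∏ j ∈ t, g j =
        f i * (∏ j ∈ t, f j - ∏ j ∈ t, g j) + (f i - g i) * ∏ j ∈ t, g j := by ring
    have h1 : 0 ≤ ∏ j ∈ t, g j := Finset.prod_nonneg fun j _ => hg0 j
    have h2 : ∏ j ∈ t, g j ≤ 1 := Finset.prod_le_one (fun j _ => hg0 j) fun j _ => hg j
    rw [e]
    refine (abs_add_le _ _).trans ?_
    rw [abs_mul, abs_mul, abs_of_nonneg (hf0 i), abs_of_nonneg h1]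
    have h3 := mul_le_of_le_one_left (abs_nonneg (∏ j ∈ t, f j - ∏ j ∈ t, g j)) (hf i)
    have h4 := mul_le_of_le_one_right (abs_nonneg (f i - g i)) h2
    have h5 := hd i
    push_cast
    linarith

theorem abs_linkProb_sub_le (h0 : ∀ v, 0 ≤ lam v) (h0' : ∀ v, 0 ≤ lam' v) {d : ℝ}
    (hd : ∀ v, |lam' v / (1 + lam' v) - lam v / (1 + lam v)| ≤ d) (D x y : Finset V) (v : V) :
    |linkProb G lam' D x y v - linkProb G lam D x y v| ≤ d := by
  have hd0 : 0 ≤ d := (abs_nonneg _).trans (hd v)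
  have h1 : 1 + lam v ≠ 0 := by have := h0 v; positivity
  have h2 : 1 + lam' v ≠ 0 := by have := h0' v; positivity
  unfold linkProb
  split_ifs
  · simpa using hd0
  · simpa using hd0
  · exact hd v
  · have e : 1 / (1 + lam' v) - 1 / (1 + lam v) =
        -(lam' v / (1 + lam' v) - lam v / (1 + lam v)) := by field_simp; ring
    rw [e, abs_neg]
    exact hd v
  · simpa using hd0
  · simpa using hd0

theorem sum_abs_glauber_sub_le (h0 : ∀ v, 0 ≤ lam v) (h0' : ∀ v, 0 ≤ lam' v) {d : ℝ}
    (hd : ∀ v, |lam' v / (1 + lam' v) - lam v / (1 + lam v)| ≤ d) (x : Finset V) :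
    ∑ y, |glauber G α lam' x y - glauber G α lam x y| ≤
      2 ^ Fintype.card V * (Fintype.card V * d) := by
  have h1 : ∀ y, |glauber G α lam' x y - glauber G α lam x y| ≤ Fintype.card V * d := fun y => by
    unfold glauber
    rw [← Finset.sum_sub_distrib]
    refine (Finset.abs_sum_le_sum_abs _ _).trans ?_
    calc _ ≤ ∑ D, (α D).toReal * (Fintype.card V * d) := Finset.sum_le_sum fun D _ => by
          rw [← mul_sub, abs_mul, abs_of_nonneg ENNReal.toReal_nonneg]
          refine mul_le_mul_of_nonneg_left ?_ ENNReal.toReal_nonneg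
          exact abs_prod_sub_prod_le Finset.univ (linkProb_nonneg h0' D x y)
            (linkProb_le_one h0' D x y) (linkProb_nonneg h0 D x y) (linkProb_le_one h0 D x y)
            (abs_linkProb_sub_le h0 h0' hd D x y)
      _ = _ := by rw [← Finset.sum_mul, pmf_sum_toReal, one_mul]
  refine (Finset.sum_le_sum fun y _ => h1 y).trans ?_
  rw [Finset.sum_const, Finset.card_univ, Fintype.card_finset, nsmul_eq_mul]
  push_cast
  exact le_rfl

/-- Activation probabilities are Lipschitz in the weights rather than in the fugacities, so slowly
varying weights give slowly varying kernels. -/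
theorem abs_logistic_sub_le (a b : ℝ) :
    |Real.exp a / (1 + Real.exp a) - Real.exp b / (1 + Real.exp b)| ≤ |a - b| := by
  wlog hab : b ≤ a generalizing a b
  · rw [abs_sub_comm, abs_sub_comm a b]
    exact this b a (le_of_not_ge hab)
  have ha := Real.exp_pos a
  have hb := Real.exp_pos b
  have e : Real.exp a / (1 + Real.exp a) - Real.exp b / (1 + Real.exp b) =
      (Real.exp a - Real.exp b) / ((1 + Real.exp a) * (1 + Real.exp b)) := by
    field_simp; ring
  have h1 : 0 ≤ Real.exp a - Real.exp b := sub_nonneg.2 (Real.exp_le_exp.2 hab)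
  have h2 : Real.exp a - Real.exp b ≤ Real.exp a * (a - b) := by
    have h3 := Real.add_one_le_exp (b - a)
    have h4 : Real.exp b = Real.exp a * Real.exp (b - a) := by rw [← Real.exp_add]; congr 1; ring
    rw [h4]
    nlinarith
  rw [e, abs_of_nonneg (by positivity), abs_of_nonneg (sub_nonneg.2 hab),
    div_le_iff₀ (by positivity)]
  have h5 : 0 ≤ a - b := sub_nonneg.2 hab
  have h6 : Real.exp a ≤ (1 + Real.exp a) * (1 + Real.exp b) := by nlinarith
  nlinarith

end Glauber

/-! ### Growth and slow variation of `h` and of the link weights. -/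

section Weights

theorem one_le_log_add_exp {x : ℝ} (hx : 0 ≤ x) : 1 ≤ Real.log (x + Real.exp 1) := by
  rw [Real.le_log_iff_exp_le (by positivity)]
  linarith

theorem h_zero : h 0 = 0 := by simp [h]

theorem h_nonneg {x : ℝ} (hx : 0 ≤ x) : 0 ≤ h x := Real.log_nonneg (one_le_log_add_exp hx)

theorem h_mono {x y : ℝ} (hx : 0 ≤ x) (hxy : x ≤ y) : h x ≤ h y := by
  have h1 := one_le_log_add_exp hx
  refine Real.log_le_log (by linarith) (Real.log_le_log (by positivity) (by linarith))

theorem h_le_log {x : ℝ} (hx : 0 ≤ x) : h x ≤ Real.log (x + Real.exp 1) := by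
  have h1 := one_le_log_add_exp hx
  have := Real.log_le_sub_one_of_pos (x := Real.log (x + Real.exp 1)) (by linarith)
  unfold h
  linarith

theorem exp_h {x : ℝ} (hx : 0 ≤ x) : Real.exp (h x) = Real.log (x + Real.exp 1) := by
  have h1 := one_le_log_add_exp hx
  exact Real.exp_log (by linarith)

theorem log_sub_log_le {x y : ℝ} (hx : 0 < x) (hxy : x ≤ y) :
    Real.log y - Real.log x ≤ (y - x) / x := by
  rw [← Real.log_div (by linarith) hx.ne']
  have := Real.log_le_sub_one_of_pos (x := y / x) (div_pos (by linarith) hx)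
  rw [sub_div, div_self hx.ne']
  exact this

theorem log_add_one_le {x : ℝ} (hx : 0 ≤ x) :
    Real.log (x + 1 + Real.exp 1) ≤ Real.log (x + Real.exp 1) + (x + Real.exp 1)⁻¹ := by
  have he := Real.exp_pos 1
  have := log_sub_log_le (x := x + Real.exp 1) (y := x + 1 + Real.exp 1) (by positivity)
    (by linarith)
  have e : (x + 1 + Real.exp 1 - (x + Real.exp 1)) / (x + Real.exp 1) = (x + Real.exp 1)⁻¹ := by
    rw [← one_div]; congr 1; ring
  linarith

theorem h_add_one_sub_le {x : ℝ} (hx : 0 ≤ x) : h (x + 1) - h x ≤ (x + Real.exp 1)⁻¹ := by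
  have he := Real.exp_pos 1
  have h1 := one_le_log_add_exp hx
  have h2 := log_add_one_le hx
  have h3 : Real.log (x + Real.exp 1) ≤ Real.log (x + 1 + Real.exp 1) :=
    Real.log_le_log (by positivity) (by linarith)
  have h4 := log_sub_log_le (by linarith) h3
  refine h4.trans ((div_le_self (by linarith) h1).trans (by linarith))

theorem two_lt_exp_one : 2 < Real.exp 1 := by
  have := Real.exp_one_gt_d9
  linarith

theorem abs_h_sub_le {n n' : ℕ} (h1 : n ≤ n' + 1) (h2 : n' ≤ n + 1) :
    |h n' - h n| ≤ 2 * ((n : ℝ) + Real.exp 1)⁻¹ := by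
  have he := two_lt_exp_one
  have hn : (0 : ℝ) < (n : ℝ) + Real.exp 1 := by positivity
  rcases (by omega : n' = n ∨ n' = n + 1 ∨ n = n' + 1) with rfl | rfl | rfl
  · rw [sub_self, abs_zero]; positivity
  · have h3 := h_add_one_sub_le (x := (n : ℝ)) (by positivity)
    have h4 := h_mono (x := (n : ℝ)) (y := n + 1) (by positivity) (by linarith)
    have h5 : 0 < ((n : ℝ) + Real.exp 1)⁻¹ := by positivity
    push_cast
    rw [abs_of_nonneg (by linarith)]
    linarith
  · have h3 := h_add_one_sub_le (x := (n' : ℝ)) (by positivity)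
    have h4 := h_mono (x := (n' : ℝ)) (y := n' + 1) (by positivity) (by linarith)
    push_cast at hn ⊢
    -- When the queue decreases, the increment is controlled at the smaller point `n'`; moving the
    -- bound to `n = n' + 1` costs the factor 2.
    rw [abs_sub_comm, abs_of_nonneg (by linarith)]
    refine h3.trans ?_
    have h6 : (0 : ℝ) < (n' : ℝ) + Real.exp 1 := by positivity
    rw [← div_eq_mul_inv, le_div_iff₀ hn, inv_mul_le_iff₀ h6]
    have : (0 : ℝ) ≤ n' := by positivity
    linarith

/-- With `y = log (X + e)`, this says that a queue of order at most `y ^ m` has `h` below `c * h X`.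
The `+ 1` and `- 1` leave room for one slot of change in the queue and in the maximum. -/
theorem eventually_log_pow_le (c : ℝ) (hc : 0 < c) (m : ℕ) :
    ∀ᶠ y : ℝ in atTop, Real.log (y ^ m + 1) ≤ (y - 1) ^ c := by
  have h1 := (isLittleO_log_rpow_atTop hc).def (c := ((m + 1 : ℕ) : ℝ)⁻¹ * (1 / 2) ^ c)
    (by positivity)
  filter_upwards [h1, eventually_ge_atTop 2] with y hy hy2
  have hy0 : 0 < y := by linarith
  have hl : 0 ≤ Real.log y := Real.log_nonneg (by linarith)
  rw [Real.norm_of_nonneg hl, Real.norm_of_nonneg (by positivity)] at hy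
  have h2 : y ^ m + 1 ≤ y ^ (m + 1) := by
    have : 1 ≤ y ^ m := one_le_pow₀ (by linarith)
    rw [pow_succ]
    nlinarith
  calc Real.log (y ^ m + 1) ≤ Real.log (y ^ (m + 1)) := Real.log_le_log (by positivity) h2
    _ = ((m + 1 : ℕ) : ℝ) * Real.log y := Real.log_pow _ _
    _ ≤ ((m + 1 : ℕ) : ℝ) * (((m + 1 : ℕ) : ℝ)⁻¹ * (1 / 2) ^ c * y ^ c) :=
        mul_le_mul_of_nonneg_left hy (by positivity)
    _ = (1 / 2 * y) ^ c := by
        rw [Real.mul_rpow (by norm_num) hy0.le]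
        field_simp
    _ ≤ (y - 1) ^ c := Real.rpow_le_rpow (by positivity) (by linarith) hc.le

theorem log_sub_one_le {X X' : ℝ} (hX : 0 ≤ X) (hX' : 0 ≤ X') (h : X ≤ X' + 1) :
    Real.log (X + Real.exp 1) - 1 ≤ Real.log (X' + Real.exp 1) := by
  have h1 := log_add_one_le hX'
  have h2 : Real.log (X + Real.exp 1) ≤ Real.log (X' + 1 + Real.exp 1) :=
    Real.log_le_log (by positivity) (by linarith)
  have h3 : (X' + Real.exp 1)⁻¹ ≤ 1 :=
    inv_le_one_of_one_le₀ (by have := two_lt_exp_one; linarith)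
  linarith

/-- The weights change slowly, uniformly in the queue of the link: one step changes
`max (h n) (c h X)` by less than any negative power of `log (X + e)`. -/
theorem exists_weight_lipschitz (c : ℝ) (hc : 0 < c) (m : ℕ) :
    ∃ C : ℝ, ∀ n n' X X' : ℕ, n ≤ n' + 1 → n' ≤ n + 1 → X ≤ X' + 1 → X' ≤ X + 1 →
      Real.log (X + Real.exp 1) ^ m * |max (h n') (c * h X') - max (h n) (c * h X)| ≤ C := by
  have he := two_lt_exp_one
  have ht : Tendsto (fun X : ℕ => (X : ℝ) + Real.exp 1) atTop atTop :=
    tendsto_atTop_add_const_right _ _ tendsto_natCast_atTop_atTop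
  have hty : Tendsto (fun X : ℕ => Real.log ((X : ℝ) + Real.exp 1)) atTop atTop :=
    Real.tendsto_log_atTop.comp ht
  have e1 := ht.eventually ((Real.isLittleO_pow_log_id_atTop (n := m)).def (c := 1) one_pos)
  have e2 := hty.eventually (eventually_log_pow_le c hc m)
  have e3 := hty.eventually (eventually_ge_atTop 2)
  obtain ⟨X₀, hX₀⟩ := eventually_atTop.1 (e1.and (e2.and e3))
  refine ⟨max 2 (2 * c) + Real.log (X₀ + Real.exp 1) ^ m * max 2 (2 * c),
    fun n n' X X' hn hn' hX hX' => ?_⟩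
  have hmax : 0 < max 2 (2 * c) := lt_max_of_lt_left two_pos
  have hy1 := one_le_log_add_exp (x := (X : ℝ)) (by positivity)
  have hy01 := one_le_log_add_exp (x := (X₀ : ℝ)) (by positivity)
  have dn := abs_h_sub_le hn hn'
  have dX : |c * h X' - c * h X| ≤ c * (2 * ((X : ℝ) + Real.exp 1)⁻¹) := by
    rw [← mul_sub, abs_mul, abs_of_pos hc]
    exact mul_le_mul_of_nonneg_left (abs_h_sub_le hX hX') hc.le
  have hinv : ∀ k : ℕ, ((k : ℝ) + Real.exp 1)⁻¹ ≤ 1 := fun k => by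
    have : (0 : ℝ) ≤ k := by positivity
    exact inv_le_one_of_one_le₀ (by linarith)
  have hd := abs_max_sub_max_le_max (h n') (c * h X') (h n) (c * h X)
  rcases lt_or_ge X X₀ with hlt | hge
  · have h1 : |max (h n') (c * h X') - max (h n) (c * h X)| ≤ max 2 (2 * c) := by
      refine hd.trans (max_le_max ?_ ?_)
      · have := hinv n; linarith
      · have := mul_le_mul_of_nonneg_left (hinv X) hc.le; linarith
    have h2 : Real.log (X + Real.exp 1) ^ m ≤ Real.log (X₀ + Real.exp 1) ^ m := by
      refine pow_le_pow_left₀ (by linarith) (Real.log_le_log (by positivity) ?_) m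
      have : (X : ℝ) ≤ X₀ := by exact_mod_cast hlt.le
      linarith
    have h3 := mul_le_mul h2 h1 (abs_nonneg _) (by positivity)
    linarith
  · obtain ⟨h1, h2, h3⟩ := hX₀ X hge
    have hpos : 0 ≤ Real.log (X₀ + Real.exp 1) ^ m * max 2 (2 * c) := by positivity
    refine le_trans ?_ (le_add_of_nonneg_right hpos)
    set y := Real.log (X + Real.exp 1) with hy
    have hym : 0 < y ^ m := by positivity
    have hX0 : (0 : ℝ) < (X : ℝ) + Real.exp 1 := by positivity
    have hyX : y ^ m * ((X : ℝ) + Real.exp 1)⁻¹ ≤ 1 := by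
      rw [Real.norm_of_nonneg hym.le, id, Real.norm_of_nonneg hX0.le, one_mul] at h1
      rw [← div_eq_mul_inv, div_le_one hX0]
      exact h1
    have hyX2 : y ^ m * |c * h X' - c * h X| ≤ 2 * c := by
      have := mul_le_mul_of_nonneg_left dX hym.le
      nlinarith
    -- Long queue: the increment of `h` is itself at most `2 * y ^ (-m)`. Short queue: before and
    -- after the slot the maximum equals its second term, which moves by only `O(1 / X)`.
    rcases le_or_gt (y ^ m) ((n : ℝ) + Real.exp 1) with hb | hb
    · have hyn : y ^ m * |h n' - h n| ≤ 2 := by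
        have hn0 : (0 : ℝ) < (n : ℝ) + Real.exp 1 := by positivity
        have h4 : y ^ m * ((n : ℝ) + Real.exp 1)⁻¹ ≤ 1 := by
          rw [← div_eq_mul_inv, div_le_one hn0]; exact hb
        have := mul_le_mul_of_nonneg_left dn hym.le
        linarith
      refine (mul_le_mul_of_nonneg_left hd hym.le).trans ?_
      rw [mul_max_of_nonneg _ _ hym.le]
      exact max_le_max hyn hyX2
    · have small : ∀ k Y : ℕ, (k : ℝ) ≤ n + 1 → (X : ℝ) ≤ Y + 1 → h k ≤ c * h Y := by
        intro k Y hk hY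
        have hk1 := one_le_log_add_exp (x := (k : ℝ)) (by positivity)
        have hl := log_sub_one_le (by positivity) (by positivity) hY
        have hl1 := one_le_log_add_exp (x := (Y : ℝ)) (by positivity)
        have h5 : Real.log (k + Real.exp 1) ≤ Real.log (Y + Real.exp 1) ^ c :=
          calc Real.log (k + Real.exp 1) ≤ Real.log (y ^ m + 1) :=
                Real.log_le_log (by positivity) (by linarith)
            _ ≤ (y - 1) ^ c := h2
            _ ≤ _ := Real.rpow_le_rpow (by linarith) hl hc.le
        calc h k ≤ Real.log (Real.log (Y + Real.exp 1) ^ c) :=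
              Real.log_le_log (by linarith) h5
          _ = c * h Y := Real.log_rpow (by linarith) c
      rw [max_eq_right (small n' X' (by exact_mod_cast hn') (by exact_mod_cast hX)),
        max_eq_right (small n X (by linarith) (by linarith))]
      exact hyX2.trans (le_max_right _ _)

end Weights

/-! ### The largest queue. -/

section MaxQueue

variable {V : Type u} [Fintype V]

theorem le_maxQueue (Q : V → ℕ) (v : V) : Q v ≤ maxQueue Q := Finset.le_sup (Finset.mem_univ v)

theorem exists_eq_maxQueue [Nonempty V] (Q : V → ℕ) : ∃ v, Q v = maxQueue Q := by
  obtain ⟨v, -, hv⟩ := Finset.exists_mem_eq_sup Finset.univ Finset.univ_nonempty Q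
  exact ⟨v, hv.symm⟩

theorem maxQueue_le_add_one {Q Q' : V → ℕ} (hQ : ∀ v, Q v ≤ Q' v + 1) :
    maxQueue Q ≤ maxQueue Q' + 1 :=
  Finset.sup_le fun v _ => (hQ v).trans (Nat.add_le_add_right (le_maxQueue Q' v) 1)

end MaxQueue

/-! ### Functionals of finite histories and their conditional expectations. -/

section SamplePaths

set_option linter.unusedSectionVars false

variable {V : Type u} [Fintype V] [DecidableEq V] {G : SimpleGraph V} [DecidableRel G.Adj]
  {T : ℕ} {α β : PMF (Finset V)} {ε : ℝ} {q₀ : V → ℕ}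

/-- A function of the sample paths that only depends on them up to time `t`. -/
def DependsUpTo (t : ℕ) (D : (ℕ → Finset V) → (ℕ → Finset V) → ℝ) : Prop :=
  ∀ a a' s s' : ℕ → Finset V, (∀ i, 1 ≤ i → i ≤ t → a i = a' i) → (∀ i ≤ t, s i = s' i) →
    D a s = D a' s'

theorem queue_congr {a a' s s' : ℕ → Finset V} (t : ℕ) (ha : ∀ i, 1 ≤ i → i ≤ t → a i = a' i)
    (hs : ∀ i ≤ t, s i = s' i) : queue q₀ a s t = queue q₀ a' s' t := by
  induction t with
  | zero => rfl
  | succ t ih =>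
    have := ih (fun i h1 h2 => ha i h1 (h2.trans t.le_succ)) (fun i h => hs i (h.trans t.le_succ))
    ext v
    simp only [queue, this, ha (t + 1) (by omega) le_rfl, hs (t + 1) le_rfl]

theorem queue_succ_le (a s : ℕ → Finset V) (t : ℕ) (v : V) :
    queue q₀ a s (t + 1) v ≤ queue q₀ a s t v + 1 := by
  simp only [queue]
  split_ifs <;> omega

theorem queue_le_succ (a s : ℕ → Finset V) (t : ℕ) (v : V) :
    queue q₀ a s t v ≤ queue q₀ a s (t + 1) v + 1 := by
  simp only [queue]
  split_ifs <;> omega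

/-- An arrival path with the given values at the times `1, …, t`. -/
def extendArrivals {t : ℕ} (p : Fin t → Finset V) (n : ℕ) : Finset V :=
  -- Truncation gives times 0 and 1 the same value; harmless, since arrivals at time 0 are never
  -- read.
  if hn : n - 1 < t then p ⟨n - 1, hn⟩ else ∅

/-- A schedule path with the given values at the times `0, …, t`. -/
def extendSchedules {t : ℕ} (p : Fin (t + 1) → Finset V) (n : ℕ) : Finset V :=
  if hn : n < t + 1 then p ⟨n, hn⟩ else ∅

variable {Ω : Type w} {A σ : ℕ → Ω → Finset V}

/-- Only finitely many histories exist. The last slot is indexed separately from the past, so that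
the transition law can be applied to it. -/
theorem pathFunctional_eq_sum_indicator {t : ℕ} {D : (ℕ → Finset V) → (ℕ → Finset V) → ℝ}
    (hD : DependsUpTo (t + 1) D) (ω : Ω) :
    D (fun i => A i ω) (fun i => σ i ω) =
      ∑ x : ((Fin t → Finset V) × (Fin (t + 1) → Finset V)) × Finset V × Finset V,
        (historyEvent A σ (Function.update (extendArrivals x.1.1) (t + 1) x.2.2)
          (Function.update (extendSchedules x.1.2) (t + 1) x.2.1) (t + 1)).indicator
          (fun _ => D (Function.update (extendArrivals x.1.1) (t + 1) x.2.2)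
            (Function.update (extendSchedules x.1.2) (t + 1) x.2.1)) ω := by
  have hA : ∀ i, 1 ≤ i → i ≤ t + 1 → A i ω =
      Function.update (extendArrivals fun k : Fin t => A (k + 1) ω) (t + 1) (A (t + 1) ω) i := by
    intro i h1 h2
    rcases eq_or_ne i (t + 1) with rfl | hne
    · simp
    · rw [Function.update_of_ne hne, extendArrivals, dif_pos (by omega)]
      simp only [Nat.sub_add_cancel h1]
  have hσ : ∀ i ≤ t + 1, σ i ω =
      Function.update (extendSchedules fun k : Fin (t + 1) => σ k ω) (t + 1) (σ (t + 1) ω) i := by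
    intro i h2
    rcases eq_or_ne i (t + 1) with rfl | hne
    · simp
    · rw [Function.update_of_ne hne, extendSchedules, dif_pos (by omega)]
  rw [Fintype.sum_eq_single
    ((fun k : Fin t => A (k + 1) ω, fun k : Fin (t + 1) => σ k ω), σ (t + 1) ω, A (t + 1) ω)]
  · rw [Set.indicator_of_mem]
    · exact hD _ _ _ _ hA hσ
    · exact ⟨hσ, hA⟩
  · rintro ⟨⟨p, q⟩, y, b⟩ hne
    refine Set.indicator_of_notMem (fun hmem => hne ?_) _
    obtain ⟨h1, h2⟩ := hmem
    have hy : y = σ (t + 1) ω := by simpa using (h1 (t + 1) le_rfl).symm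
    have hb : b = A (t + 1) ω := by simpa using (h2 (t + 1) (by omega) le_rfl).symm
    have hq : q = fun k : Fin (t + 1) => σ k ω := by
      ext1 k
      have := h1 k (by omega)
      rw [Function.update_of_ne (by omega), extendSchedules, dif_pos k.2] at this
      exact this.symm
    have hp : p = fun k : Fin t => A (k + 1) ω := by
      ext1 k
      have := h2 (k + 1) (by omega) (by omega)
      rw [Function.update_of_ne (by omega), extendArrivals, dif_pos (by omega)] at this
      exact this.symm
    rw [hy, hb, hq, hp]

variable [MeasurableSpace Ω] {P : Measure Ω} [IsProbabilityMeasure P]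

theorem IsDelayedCSMA.measurableSet_historyEvent (H : IsDelayedCSMA G T α β ε q₀ P A σ)
    (a s : ℕ → Finset V) (t : ℕ) : MeasurableSet (historyEvent A σ a s t) := by
  have : historyEvent A σ a s t = (⋂ i, ⋂ (_ : i ≤ t), {ω | σ i ω = s i}) ∩
      ⋂ i, ⋂ (_ : 1 ≤ i), ⋂ (_ : i ≤ t), {ω | A i ω = a i} := by
    ext ω
    simp [historyEvent]
  rw [this]
  exact (MeasurableSet.iInter fun i => MeasurableSet.iInter fun _ =>
    H.measurable_schedule i _).inter (MeasurableSet.iInter fun i => MeasurableSet.iInter fun _ =>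
      MeasurableSet.iInter fun _ => H.measurable_arrivals i _)

theorem IsDelayedCSMA.integrable (H : IsDelayedCSMA G T α β ε q₀ P A σ) {t : ℕ}
    {D : (ℕ → Finset V) → (ℕ → Finset V) → ℝ} (hD : DependsUpTo t D) :
    Integrable (fun ω => D (fun i => A i ω) (fun i => σ i ω)) P := by
  have hD' : DependsUpTo (t + 1) D := fun a a' s s' ha hs =>
    hD a a' s s' (fun i h1 h2 => ha i h1 (h2.trans t.le_succ)) fun i h => hs i (h.trans t.le_succ)
  simp_rw [pathFunctional_eq_sum_indicator hD']
  exact integrable_finsetSum _ fun x _ =>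
    (integrable_const _).indicator (H.measurableSet_historyEvent _ _ _)

theorem scheduleProb_congr (hT : 1 ≤ T) {a a' s s' : ℕ → Finset V} (t : ℕ)
    (ha : ∀ i, 1 ≤ i → i ≤ t → a i = a' i) (hs : ∀ i ≤ t, s i = s' i) (y : Finset V) :
    scheduleProb G T α ε q₀ a s t y = scheduleProb G T α ε q₀ a' s' t y := by
  unfold scheduleProb
  -- Here `T ≥ 1` is needed: the schedule consulted must belong to the past.
  rw [queue_congr t ha hs, hs (t + 1 - T) (by omega)]

theorem IsDelayedCSMA.integral_eq_sum (H : IsDelayedCSMA G T α β ε q₀ P A σ) {t : ℕ}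
    {D : (ℕ → Finset V) → (ℕ → Finset V) → ℝ} (hD : DependsUpTo (t + 1) D) :
    ∫ ω, D (fun i => A i ω) (fun i => σ i ω) ∂P =
      ∑ x : ((Fin t → Finset V) × (Fin (t + 1) → Finset V)) × Finset V × Finset V,
        P.real (historyEvent A σ (Function.update (extendArrivals x.1.1) (t + 1) x.2.2)
          (Function.update (extendSchedules x.1.2) (t + 1) x.2.1) (t + 1)) *
          D (Function.update (extendArrivals x.1.1) (t + 1) x.2.2)
            (Function.update (extendSchedules x.1.2) (t + 1) x.2.1) := by
  rw [integral_congr_ae (Eventually.of_forall fun ω => pathFunctional_eq_sum_indicator hD ω),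
    integral_finsetSum _ fun x _ =>
      (integrable_const _).indicator (H.measurableSet_historyEvent _ _ _)]
  exact Finset.sum_congr rfl fun x _ =>
    integral_indicator_const _ (H.measurableSet_historyEvent _ _ _)

/-- If the conditional expectation of `D` given the past is never positive, then neither is its
expectation. -/
theorem IsDelayedCSMA.integral_nonpos (H : IsDelayedCSMA G T α β ε q₀ P A σ) (hT : 1 ≤ T) {t : ℕ}
    {D : (ℕ → Finset V) → (ℕ → Finset V) → ℝ} (hD : DependsUpTo (t + 1) D)
    (hneg : ∀ a s : ℕ → Finset V, ∑ y, ∑ b, scheduleProb G T α ε q₀ a s t y * (β b).toReal *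
      D (Function.update a (t + 1) b) (Function.update s (t + 1) y) ≤ 0) :
    ∫ ω, D (fun i => A i ω) (fun i => σ i ω) ∂P ≤ 0 := by
  rw [H.integral_eq_sum hD, Fintype.sum_prod_type]
  refine Finset.sum_nonpos fun x _ => ?_
  rw [Fintype.sum_prod_type]
  set a := extendArrivals x.1
  set s := extendSchedules x.2
  have hE : ∀ y b : Finset V, historyEvent A σ (Function.update a (t + 1) b)
      (Function.update s (t + 1) y) t = historyEvent A σ a s t := fun y b => by
    ext ω
    refine and_congr ?_ ?_
    · exact forall_congr' fun i => forall_congr' fun hi => by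
        rw [Function.update_of_ne (by omega)]
    · exact forall_congr' fun i => forall_congr' fun _ => forall_congr' fun hi => by
        rw [Function.update_of_ne (by omega)]
  have hS : ∀ y b z : Finset V, scheduleProb G T α ε q₀ (Function.update a (t + 1) b)
      (Function.update s (t + 1) y) t z = scheduleProb G T α ε q₀ a s t z := fun y b z =>
    scheduleProb_congr hT t (fun i _ hi => by rw [Function.update_of_ne (by omega)])
      (fun i hi => by rw [Function.update_of_ne (by omega)]) z
  have hfin : ∑ y, ∑ b, (P.real (historyEvent A σ a s t) * (scheduleProb G T α ε q₀ a s t y *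
      (β b).toReal)) * D (Function.update a (t + 1) b) (Function.update s (t + 1) y) ≤ 0 := by
    have := mul_nonpos_of_nonneg_of_nonpos (measureReal_nonneg (μ := P)
      (s := historyEvent A σ a s t)) (hneg a s)
    simp_rw [Finset.mul_sum] at this
    simpa only [mul_assoc] using this
  refine le_of_eq_of_le (Finset.sum_congr rfl fun y _ => Finset.sum_congr rfl fun b _ => ?_) hfin
  have htr := H.transition (Function.update a (t + 1) b) (Function.update s (t + 1) y) t
  rw [hE, hS, Function.update_self, Function.update_self] at htr
  rw [← htr]

end SamplePaths

/-! ### The corrector and its bounded increments. -/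

section Corrector

set_option linter.unusedSectionVars false

variable {V : Type u} [Fintype V] [DecidableEq V] {G : SimpleGraph V} [DecidableRel G.Adj]
  {α : PMF (Finset V)} {ε : ℝ}

theorem h_le_weight (ε : ℝ) (Q : V → ℕ) (v : V) : h (Q v) ≤ weight ε Q v := le_max_left _ _

theorem weight_nonneg (ε : ℝ) (Q : V → ℕ) (v : V) : 0 ≤ weight ε Q v :=
  (h_nonneg (Nat.cast_nonneg _)).trans (h_le_weight ε Q v)

theorem weight_le (hε : 0 ≤ ε) (Q : V → ℕ) (v : V) :
    weight ε Q v ≤ h (Q v) + ε / (2 * (Fintype.card V : ℝ)) * h (maxQueue Q) := by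
  have h1 := h_nonneg (Nat.cast_nonneg (Q v))
  have h2 := h_nonneg (Nat.cast_nonneg (maxQueue Q))
  have h3 : 0 ≤ ε / (2 * (Fintype.card V : ℝ)) * h (maxQueue Q) := by positivity
  exact max_le (by linarith) (by linarith)

theorem weight_le_h_maxQueue [Nonempty V] (hε1 : ε ≤ 1) (Q : V → ℕ) (v : V) :
    weight ε Q v ≤ h (maxQueue Q) := by
  refine max_le (h_mono (Nat.cast_nonneg _) (by exact_mod_cast le_maxQueue Q v)) ?_
  refine mul_le_of_le_one_left (h_nonneg (Nat.cast_nonneg _)) ?_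
  have : (1 : ℝ) ≤ Fintype.card V := by exact_mod_cast Fintype.card_pos
  rw [div_le_one (by positivity)]
  linarith

theorem exists_decision_lower_bound (hα : IsDecisionLaw G α) :
    ∃ a : ℝ, 0 < a ∧ ∀ v, ∃ D, v ∈ D ∧ a ≤ (α D).toReal := by
  choose D hD hv using hα.2
  have hpos : ∀ v, 0 < (α (D v)).toReal := fun v =>
    ENNReal.toReal_pos ((PMF.mem_support_iff _ _).1 (hD v)) (α.apply_ne_top _)
  rcases isEmpty_or_nonempty V with hV | hV
  · exact ⟨1, one_pos, fun v => (hV.false v).elim⟩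
  · obtain ⟨v₀, -, hmin⟩ := Finset.exists_min_image Finset.univ (fun v => (α (D v)).toReal)
      Finset.univ_nonempty
    exact ⟨_, hpos v₀, fun v => ⟨D v, hv v, hmin v (Finset.mem_univ v)⟩⟩

/-- The corrector: it solves the Poisson equation of the Glauber dynamics with the current
fugacities, and changes by a bounded amount in each time slot. -/
theorem exists_corrector [Nonempty V] (hα : IsDecisionLaw G α) (hε : 0 < ε) (hε1 : ε ≤ 1) :
    ∃ (g : (V → ℕ) → Finset V → ℝ) (C : ℝ),
      (∀ Q x S, Feasible G S → ∑ v ∈ S, weight ε Q v - 2 ^ Fintype.card V ≤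
        ∑ y, glauber G α (fugacity ε Q) x y * (g Q y + ∑ v ∈ y, weight ε Q v) - g Q x) ∧
      ∀ Q Q' x, (∀ v, Q v ≤ Q' v + 1) → (∀ v, Q' v ≤ Q v + 1) → |g Q' x - g Q x| ≤ C := by
  obtain ⟨a, ha0, ha⟩ := exists_decision_lower_bound hα
  set N := Fintype.card V with hN
  have hNpos : (0 : ℝ) < N := by exact_mod_cast Fintype.card_pos
  let Y : (V → ℕ) → ℝ := fun Q => Real.log (maxQueue Q + Real.exp 1)
  have hY1 : ∀ Q, 1 ≤ Y Q := fun Q => one_le_log_add_exp (Nat.cast_nonneg _)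
  have hlam0 : ∀ (Q : V → ℕ) v, 0 < fugacity ε Q v := fun Q v => Real.exp_pos _
  have hlam : ∀ (Q : V → ℕ) v, fugacity ε Q v ≤ Y Q := fun Q v => by
    change _ ≤ Real.log (maxQueue Q + Real.exp 1)
    rw [← exp_h (Nat.cast_nonneg _)]
    exact Real.exp_le_exp.2 (weight_le_h_maxQueue hε1 Q v)
  have H := fun Q => glauber_driftChain hα (hlam0 Q) (hlam Q) ha0 ha
  set κ : (V → ℕ) → ℝ := fun Q => (a * ((1 + Y Q)⁻¹) ^ N / 2) ^ (N + 1) with hκ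
  let f : (V → ℕ) → Finset V → ℝ := fun Q x => ∑ v ∈ x, weight ε Q v
  choose g hg0 hg using fun Q => (H Q).exists_poisson (f Q)
  set m := N * (N + 1) with hm
  -- The 3 leaves room to bound `κ Q'` after one slot in terms of `y = Y Q`: `1 + Y Q' ≤ y + 2 ≤ 3 *
  -- y`.
  set B : ℝ := (2 * 3 ^ N / a) ^ (N + 1) with hB
  have hB0 : 0 < B := by positivity
  have hκB : ∀ Q (y : ℝ), 1 ≤ y → 1 + Y Q ≤ 3 * y → (κ Q)⁻¹ ≤ B * y ^ m := by
    intro Q y hy hQ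
    have h1 := hY1 Q
    have e : (κ Q)⁻¹ = (2 * (1 + Y Q) ^ N / a) ^ (N + 1) := by
      rw [hκ]
      simp only
      rw [← inv_pow]
      congr 1
      rw [inv_pow]
      field_simp
    have e2 : B * y ^ m = (2 * (3 * y) ^ N / a) ^ (N + 1) := by
      rw [hB, hm, pow_mul, ← mul_pow, mul_pow 3 y N]
      congr 1
      ring
    rw [e, e2]
    gcongr
  have hκ0 : ∀ Q, 0 < κ Q := fun Q => by have := hY1 Q; positivity
  have hf : ∀ Q x, |f Q x| ≤ N * Y Q := fun Q x => by
    rw [abs_of_nonneg (Finset.sum_nonneg fun v _ => weight_nonneg ε Q v)]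
    have hw : ∀ v, weight ε Q v ≤ Y Q := fun v =>
      (weight_le_h_maxQueue hε1 Q v).trans (h_le_log (Nat.cast_nonneg _))
    calc f Q x ≤ ∑ v ∈ x, Y Q := Finset.sum_le_sum fun v _ => hw v
      _ = x.card * Y Q := by rw [Finset.sum_const, nsmul_eq_mul]
      _ ≤ N * Y Q := by
        have := hY1 Q
        gcongr
        exact Finset.card_le_univ x
  have hgG : ∀ Q x, |g Q x| ≤ 2 * N * Y Q * (B * Y Q ^ m) := fun Q x => by
    have h1 := hY1 Q
    refine ((H Q).abs_poisson_le (hg0 Q) (hg Q) (b := 2 * N * Y Q) (fun x => ?_) x).trans ?_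
    · have h2 := abs_le.1 (hf Q x)
      have h3 := abs_le.1 ((H Q).abs_stat_le (hf Q))
      exact abs_le.2 ⟨by linarith, by linarith⟩
    · rw [div_eq_mul_inv]
      exact mul_le_mul_of_nonneg_left (hκB Q (Y Q) h1 (by linarith)) (by positivity)
  -- The exponent collects one factor `y ^ m` from the size of `g Q`, a second from inverting the
  -- killed chain at `Q'`, and one `y` from the size of `f`.
  obtain ⟨Cw, hCw⟩ := exists_weight_lipschitz (ε / (2 * N)) (by positivity) (2 * m + 1)
  refine ⟨fun Q x => g Q x - f Q x,
    2 * B * N * (1 + 2 ^ N * (2 * N * B)) * Cw + N * Cw, fun Q x S hS => ?_,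
    fun Q Q' x hQ hQ' => ?_⟩
  · have h1 := hg Q x
    have h2 := le_sum_gibbs (weight ε Q) hS
    have h3 : ∑ y, glauber G α (fugacity ε Q) x y * (g Q y - f Q y + f Q y) =
        ∑ y, glauber G α (fugacity ε Q) x y * g Q y :=
      Finset.sum_congr rfl fun y _ => by ring
    change _ ≤ ∑ y, glauber G α (fugacity ε Q) x y * (g Q y - f Q y + f Q y) - _
    rw [h3]
    have h4 : ∑ v ∈ S, weight ε Q v - 2 ^ N ≤ ∑ y, gibbs G (fugacity ε Q) y * f Q y := h2
    linarith
  · set y := Y Q with hy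
    have hy1 : 1 ≤ y := hY1 Q
    have hX := maxQueue_le_add_one hQ
    have hX' := maxQueue_le_add_one hQ'
    have hwy : ∀ v, y ^ (2 * m + 1) * |weight ε Q' v - weight ε Q v| ≤ Cw := fun v =>
      hCw (Q v) (Q' v) (maxQueue Q) (maxQueue Q') (hQ v) (hQ' v) hX hX'
    have hypos : 0 < y ^ (2 * m + 1) := by positivity
    set d := Cw / y ^ (2 * m + 1) with hd
    have hw : ∀ v, |weight ε Q' v - weight ε Q v| ≤ d := fun v => by
      rw [hd, le_div_iff₀ hypos, mul_comm]; exact hwy v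
    have hdC : d * y ^ (2 * m + 1) = Cw := div_mul_cancel₀ _ hypos.ne'
    have hd0 : 0 ≤ d := (abs_nonneg _).trans (hw (Classical.arbitrary V))
    have hdf : ∀ x, |f Q' x - f Q x| ≤ N * d := fun x => by
      rw [← Finset.sum_sub_distrib]
      refine (Finset.abs_sum_le_sum_abs _ _).trans ((Finset.sum_le_sum fun v _ => hw v).trans ?_)
      rw [Finset.sum_const, nsmul_eq_mul]
      gcongr
      exact Finset.card_le_univ x
    have hdP := sum_abs_glauber_sub_le (G := G) (α := α) (lam := fugacity ε Q)
      (lam' := fugacity ε Q') (fun v => (hlam0 Q v).le) (fun v => (hlam0 Q' v).le) (d := d)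
      (fun v => (abs_logistic_sub_le _ _).trans (hw v))
    have hY' : 1 + Y Q' ≤ 3 * y := by
      have h1 := log_sub_one_le (X := maxQueue Q') (X' := maxQueue Q) (Nat.cast_nonneg _)
        (Nat.cast_nonneg _) (by exact_mod_cast hX')
      have h2 : Y Q' - 1 ≤ y := h1
      linarith
    have hmain := DriftChain.abs_poisson_sub_le (H Q') (hg0 Q) (hg0 Q') (hg Q) (hg Q') hdf hdP
      (hgG Q) x
    have h1 : |g Q' x - g Q x| ≤ 2 * B * N * (1 + 2 ^ N * (2 * N * B)) * Cw := by
      refine hmain.trans ?_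
      rw [div_eq_mul_inv]
      refine (mul_le_mul_of_nonneg_left (hκB Q' y hy1 hY') (by positivity)).trans ?_
      have hle : (1 : ℝ) ≤ y ^ (m + 1) := one_le_pow₀ hy1
      calc 2 * (N * d + 2 ^ N * (N * d) * (2 * N * y * (B * y ^ m))) * (B * y ^ m)
          = 2 * B * N * d * y ^ m * (1 + 2 ^ N * (2 * N * B) * y ^ (m + 1)) := by ring
        _ ≤ 2 * B * N * d * y ^ m * (y ^ (m + 1) + 2 ^ N * (2 * N * B) * y ^ (m + 1)) := by
            gcongr
        _ = 2 * B * N * (1 + 2 ^ N * (2 * N * B)) * (d * y ^ (2 * m + 1)) := by ring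
        _ = _ := by rw [hdC]
    have h2 : |f Q' x - f Q x| ≤ N * Cw := by
      refine (hdf x).trans (mul_le_mul_of_nonneg_left ?_ hNpos.le)
      rw [← hdC]
      exact le_mul_of_one_le_right hd0 (one_le_pow₀ hy1)
    have h3 := abs_le.1 h1
    have h4 := abs_le.1 h2
    exact abs_le.2 ⟨by linarith, by linarith⟩

end Corrector

/-! ### One-slot drift of the Lyapunov function. -/

section Drift

set_option linter.unusedSectionVars false

variable {V : Type u} [Fintype V] [DecidableEq V] {G : SimpleGraph V} [DecidableRel G.Adj]
  {T : ℕ} {α β : PMF (Finset V)} {ε : ℝ} {q₀ : V → ℕ}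

theorem sum_mul_scheduleVector (c : V → ℝ) (S : Finset V) :
    ∑ v, c v * scheduleVector S v = ∑ v ∈ S, c v := by
  simp [scheduleVector]

/-- A feasible schedule of maximal weight outweighs all points of the capacity region. -/
theorem exists_maxWeight (G : SimpleGraph V) (c : V → ℝ) :
    ∃ S, Feasible G S ∧ (∀ S', Feasible G S' → ∑ v ∈ S', c v ≤ ∑ v ∈ S, c v) ∧
      ∀ ζ ∈ capacityRegion G, ∑ v, c v * ζ v ≤ ∑ v ∈ S, c v := by
  classical
  obtain ⟨S, hS, hmax⟩ := Finset.exists_max_image (Finset.univ.filter (Feasible G))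
    (fun S => ∑ v ∈ S, c v) ⟨∅, by simp [feasible_empty]⟩
  have hmax' : ∀ S', Feasible G S' → ∑ v ∈ S', c v ≤ ∑ v ∈ S, c v := fun S' hS' =>
    hmax S' (by simp [hS'])
  refine ⟨S, by simpa using hS, hmax', fun ζ hζ => ?_⟩
  have hlin : IsLinearMap ℝ fun ζ : V → ℝ => ∑ v, c v * ζ v :=
    { map_add := fun x y => by simp [mul_add, Finset.sum_add_distrib]
      map_smul := fun r x => by
        simp only [Pi.smul_apply, smul_eq_mul, Finset.mul_sum]
        exact Finset.sum_congr rfl fun v _ => by ring }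
  refine convexHull_min ?_ (convex_halfSpace_le hlin (∑ v ∈ S, c v)) hζ
  rintro _ ⟨S', hS', rfl⟩
  exact (sum_mul_scheduleVector c S').trans_le (hmax' S' hS')

theorem HasArrivalRate.sum_mul {η : V → ℝ} (hβ : HasArrivalRate β η) (c : V → ℝ) :
    ∑ b, (β b).toReal * ∑ v, c v * (if v ∈ b then 1 else 0) = ∑ v, c v * η v := by
  simp_rw [Finset.mul_sum]
  rw [Finset.sum_comm]
  refine Finset.sum_congr rfl fun v _ => ?_
  rw [← hβ v, Finset.mul_sum]
  refine Finset.sum_congr rfl fun b _ => ?_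
  split_ifs <;> ring

theorem sum_sum_mul_add {X Y : Type*} [Fintype X] [Fintype Y] {p : X → ℝ} {q : Y → ℝ}
    (hp : ∑ x, p x = 1) (hq : ∑ y, q y = 1) (F : X → ℝ) (K : Y → ℝ) :
    ∑ x, ∑ y, p x * q y * (F x + K y) = ∑ x, p x * F x + ∑ y, q y * K y := by
  have : ∀ x, ∑ y, p x * q y * (F x + K y) = p x * F x + p x * ∑ y, q y * K y := fun x => by
    rw [Finset.mul_sum, ← mul_one (p x * F x), ← hq, Finset.mul_sum, ← Finset.sum_add_distrib]
    exact Finset.sum_congr rfl fun y _ => by ring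
  simp_rw [this]
  rw [Finset.sum_add_distrib, ← Finset.sum_mul, hp, one_mul]

/-- A discrete primitive of `h`. -/
def queueEnergy (n : ℕ) : ℝ := ∑ k ∈ Finset.range n, h k

theorem queueEnergy_nonneg (n : ℕ) : 0 ≤ queueEnergy n :=
  Finset.sum_nonneg fun k _ => h_nonneg (Nat.cast_nonneg k)

theorem queueEnergy_succ (n : ℕ) : queueEnergy (n + 1) = queueEnergy n + h n :=
  Finset.sum_range_succ _ _

/-- The `+ 1` is needed because a departure from `n + 1` releases `h n` instead of `h (n + 1)`.
Service of an empty queue costs nothing since `h 0 = 0`. -/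
theorem queueEnergy_step_le (n : ℕ) (p q : Prop) [Decidable p] [Decidable q] :
    queueEnergy (n + (if p then 1 else 0) - (if q then 1 else 0)) - queueEnergy n ≤
      h n * (if p then 1 else 0) - h n * (if q then 1 else 0) + 1 := by
  by_cases hp : p <;> by_cases hq : q
  · simp [hp, hq]
  · simp [hp, hq, queueEnergy_succ]
  · rcases n with _ | n
    · simp [hp, hq, h_zero]
    · have h1 := h_add_one_sub_le (x := (n : ℝ)) (Nat.cast_nonneg n)
      have h2 : ((n : ℝ) + Real.exp 1)⁻¹ ≤ 1 :=
        inv_le_one_of_one_le₀ (by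
          have := two_lt_exp_one
          have : (0 : ℝ) ≤ n := Nat.cast_nonneg n
          linarith)
      simp only [hp, hq, if_true, if_false, add_zero, Nat.add_sub_cancel, queueEnergy_succ]
      push_cast
      linarith
  · simp [hp, hq]

/-- The energy of the queues at time `t`. -/
def totalEnergy (Q : V → ℕ) : ℝ := ∑ v, queueEnergy (Q v)

theorem totalEnergy_nonneg (Q : V → ℕ) : 0 ≤ totalEnergy Q :=
  Finset.sum_nonneg fun v _ => queueEnergy_nonneg (Q v)

theorem totalEnergy_queue_succ_le (a s : ℕ → Finset V) (t : ℕ) :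
    totalEnergy (queue q₀ a s (t + 1)) - totalEnergy (queue q₀ a s t) ≤
      ∑ v, h (queue q₀ a s t v) * (if v ∈ a (t + 1) then 1 else 0) -
        ∑ v ∈ s (t + 1), h (queue q₀ a s t v) + Fintype.card V := by
  have e : ∑ v ∈ s (t + 1), h (queue q₀ a s t v) =
      ∑ v, h (queue q₀ a s t v) * (if v ∈ s (t + 1) then 1 else 0) := by simp
  have e2 : (Fintype.card V : ℝ) = ∑ _v : V, (1 : ℝ) := by simp
  rw [e, e2, totalEnergy, totalEnergy, ← Finset.sum_sub_distrib, ← Finset.sum_sub_distrib,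
    ← Finset.sum_add_distrib]
  exact Finset.sum_le_sum fun v _ => queueEnergy_step_le _ _ _

/-- With `M` the maximal `h`-weight of a feasible schedule, arrivals contribute at most `(1 - ε) *
M` and corrected service at least `M` up to constants and `g x`. Passing from weights to `h` costs
`ε / 2 * h(Q_max)`, since each link's floor adds at most `ε / (2 * |V|) * h(Q_max)`. As single links
are feasible, `M ≥ h(Q_max)`, and half of the slack survives. -/
theorem conditional_drift_le [Nonempty V] (hε : 0 < ε) (hε1 : ε ≤ 1) {η : V → ℝ}
    (hη : η ∈ (1 - ε) • capacityRegion G) (hβ : HasArrivalRate β η) (Q : V → ℕ) (x : Finset V)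
    {g : Finset V → ℝ} (hg : ∀ S, Feasible G S → ∑ v ∈ S, weight ε Q v - 2 ^ Fintype.card V ≤
      ∑ y, glauber G α (fugacity ε Q) x y * (g y + ∑ v ∈ y, weight ε Q v) - g x) :
    ∑ y, ∑ b, glauber G α (fugacity ε Q) x y * (β b).toReal *
      ((-(∑ v ∈ y, h (Q v)) - g y) + ∑ v, h (Q v) * (if v ∈ b then 1 else 0)) ≤
      2 ^ Fintype.card V - ε / 2 * h (maxQueue Q) - g x := by
  have hfug : ∀ v, 0 ≤ fugacity ε Q v := fun v => (Real.exp_pos _).le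
  rw [sum_sum_mul_add (glauber_row_sum hfug x) (pmf_sum_toReal β), hβ.sum_mul]
  obtain ⟨S, hS, hmax, hcap⟩ := exists_maxWeight G fun v => h (Q v)
  have hX0 : 0 ≤ h (maxQueue Q) := h_nonneg (Nat.cast_nonneg _)
  have hX : h (maxQueue Q) ≤ ∑ v ∈ S, h (Q v) := by
    obtain ⟨v, hv⟩ := exists_eq_maxQueue Q
    have := hmax {v} (by simp [Feasible, SimpleGraph.IsIndepSet])
    rwa [Finset.sum_singleton, hv] at this
  have hrate : ∑ v, h (Q v) * η v ≤ (1 - ε) * ∑ v ∈ S, h (Q v) := by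
    obtain ⟨ζ, hζ, rfl⟩ := hη
    have e : ∑ v, h (Q v) * ((1 - ε) • ζ) v = (1 - ε) * ∑ v, h (Q v) * ζ v := by
      rw [Finset.mul_sum]
      exact Finset.sum_congr rfl fun v _ => by simp only [Pi.smul_apply, smul_eq_mul]; ring
    simp only [e]
    exact mul_le_mul_of_nonneg_left (hcap ζ hζ) (by linarith)
  have hWS : ∑ v ∈ S, h (Q v) ≤ ∑ v ∈ S, weight ε Q v :=
    Finset.sum_le_sum fun v _ => h_le_weight ε Q v
  have hW : ∀ y : Finset V,
      -(∑ v ∈ y, h (Q v)) ≤ ε / 2 * h (maxQueue Q) - ∑ v ∈ y, weight ε Q v := fun y => by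
    have hN : (0 : ℝ) < Fintype.card V := by exact_mod_cast Fintype.card_pos
    have h1 : ∑ v ∈ y, weight ε Q v ≤ ∑ v ∈ y, h (Q v) +
        y.card * (ε / (2 * (Fintype.card V : ℝ)) * h (maxQueue Q)) := by
      rw [← nsmul_eq_mul, ← Finset.sum_const, ← Finset.sum_add_distrib]
      exact Finset.sum_le_sum fun v _ => weight_le hε.le Q v
    have h2 : (y.card : ℝ) * (ε / (2 * (Fintype.card V : ℝ)) * h (maxQueue Q)) ≤
        Fintype.card V * (ε / (2 * (Fintype.card V : ℝ)) * h (maxQueue Q)) := by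
      gcongr
      exact Finset.card_le_univ y
    have h3 : (Fintype.card V : ℝ) * (ε / (2 * (Fintype.card V : ℝ)) * h (maxQueue Q)) =
        ε / 2 * h (maxQueue Q) := by field_simp
    linarith
  have hsum : ∑ y, glauber G α (fugacity ε Q) x y * (-(∑ v ∈ y, h (Q v)) - g y) ≤
      ε / 2 * h (maxQueue Q) -
        ∑ y, glauber G α (fugacity ε Q) x y * (g y + ∑ v ∈ y, weight ε Q v) := by
    have e : ε / 2 * h (maxQueue Q) =
        ∑ y, glauber G α (fugacity ε Q) x y * (ε / 2 * h (maxQueue Q)) := by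
      rw [← Finset.sum_mul, glauber_row_sum hfug, one_mul]
    rw [e, ← Finset.sum_sub_distrib]
    refine Finset.sum_le_sum fun y _ => ?_
    rw [← mul_sub]
    exact mul_le_mul_of_nonneg_left (by have := hW y; linarith) (glauber_nonneg hfug x y)
  have := hg S hS
  have h1 := mul_le_mul_of_nonneg_left hX hε.le
  linarith

/-- The Lyapunov function: the energy of the queues, corrected by the solution of the Poisson
equation at the last `T` schedules. -/
def lyapunov (T : ℕ) (g : (V → ℕ) → Finset V → ℝ) (q₀ : V → ℕ) (t : ℕ) (a s : ℕ → Finset V) : ℝ :=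
  totalEnergy (queue q₀ a s t) - ∑ j ∈ Finset.range T, g (queue q₀ a s t) (s (t - j))

theorem dependsUpTo_lyapunov (g : (V → ℕ) → Finset V → ℝ) (t : ℕ) :
    DependsUpTo t (lyapunov T g q₀ t) := fun a a' s s' ha hs => by
  unfold lyapunov
  rw [queue_congr t ha hs]
  congr 1
  exact Finset.sum_congr rfl fun j _ => by rw [hs _ (Nat.sub_le t j)]

theorem dependsUpTo_maxQueue (t : ℕ) :
    DependsUpTo t fun a s => h (maxQueue (queue q₀ a s t)) := fun a a' s s' ha hs => by
  simp only [queue_congr t ha hs]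

theorem abs_corrector_queue_le {g : (V → ℕ) → Finset V → ℝ} {C : ℝ}
    (hlip : ∀ Q Q' x, (∀ v, Q v ≤ Q' v + 1) → (∀ v, Q' v ≤ Q v + 1) → |g Q' x - g Q x| ≤ C)
    (a s : ℕ → Finset V) (t : ℕ) (x : Finset V) :
    |g (queue q₀ a s t) x| ≤ ∑ y, |g q₀ y| + C * t := by
  induction t with
  | zero =>
    simpa [queue] using Finset.single_le_sum (f := fun y => |g q₀ y|)
      (fun y _ => abs_nonneg _) (Finset.mem_univ x)
  | succ t ih =>
    have h1 := hlip (queue q₀ a s t) (queue q₀ a s (t + 1)) x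
      (fun v => queue_le_succ a s t v) (fun v => queue_succ_le a s t v)
    have h2 := abs_le.1 h1
    have h3 := abs_le.1 ih
    push_cast
    exact abs_le.2 ⟨by linarith, by linarith⟩

/-- The corrector has no sign, but bounded increments make it grow at most linearly in time; a
linear lower bound is harmless for a time average. -/
theorem neg_le_lyapunov {g : (V → ℕ) → Finset V → ℝ} {C : ℝ}
    (hlip : ∀ Q Q' x, (∀ v, Q v ≤ Q' v + 1) → (∀ v, Q' v ≤ Q v + 1) → |g Q' x - g Q x| ≤ C)
    (a s : ℕ → Finset V) (t : ℕ) :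
    -(T * (∑ y, |g q₀ y| + C * t)) ≤ lyapunov T g q₀ t a s := by
  have h1 : ∑ j ∈ Finset.range T, g (queue q₀ a s t) (s (t - j)) ≤
      T * (∑ y, |g q₀ y| + C * t) := by
    calc _ ≤ ∑ j ∈ Finset.range T, (∑ y, |g q₀ y| + C * t) :=
          Finset.sum_le_sum fun j _ => (le_abs_self _).trans (abs_corrector_queue_le hlip a s t _)
      _ = _ := by rw [Finset.sum_const, Finset.card_range, nsmul_eq_mul]
  have h2 := totalEnergy_nonneg (queue q₀ a s t)
  unfold lyapunov
  linarith

/-- With `T = k + 1`, the schedules common to both windows cancel up to `C` each, because only the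
queues have changed. What remains is the entering `s (t + 1)` and the leaving `s (t - k)`. -/
theorem lyapunov_succ_sub_le {g : (V → ℕ) → Finset V → ℝ} {C : ℝ} (k : ℕ)
    (hlip : ∀ Q Q' x, (∀ v, Q v ≤ Q' v + 1) → (∀ v, Q' v ≤ Q v + 1) → |g Q' x - g Q x| ≤ C)
    (a s : ℕ → Finset V) (t : ℕ) :
    lyapunov (k + 1) g q₀ (t + 1) a s - lyapunov (k + 1) g q₀ t a s ≤
      ((-(∑ v ∈ s (t + 1), h (queue q₀ a s t v)) - g (queue q₀ a s t) (s (t + 1))) +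
        ∑ v, h (queue q₀ a s t v) * (if v ∈ a (t + 1) then 1 else 0)) +
        (g (queue q₀ a s t) (s (t - k)) + (k + 1) * C + Fintype.card V) := by
  have h1 := totalEnergy_queue_succ_le (q₀ := q₀) a s t
  have hd : ∀ x, g (queue q₀ a s t) x - g (queue q₀ a s (t + 1)) x ≤ C := fun x => by
    have := abs_le.1 (hlip (queue q₀ a s t) (queue q₀ a s (t + 1)) x
      (fun v => queue_le_succ a s t v) (fun v => queue_succ_le a s t v))
    linarith
  have h2 : ∑ j ∈ Finset.range k, g (queue q₀ a s t) (s (t - j)) -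
      ∑ j ∈ Finset.range k, g (queue q₀ a s (t + 1)) (s (t - j)) ≤ k * C := by
    rw [← Finset.sum_sub_distrib]
    refine (Finset.sum_le_sum fun j _ => hd (s (t - j))).trans_eq ?_
    rw [Finset.sum_const, Finset.card_range, nsmul_eq_mul]
  have h3 := hd (s (t + 1))
  unfold lyapunov
  rw [Finset.sum_range_succ', Finset.sum_range_succ (fun j => g (queue q₀ a s t) (s (t - j)))]
  simp only [Nat.add_sub_add_right, Nat.sub_zero]
  linarith

end Drift

/-! ### From drift to stability, and the degenerate cases. -/

section Stability

set_option linter.unusedSectionVars false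

variable {V : Type u} [Fintype V] [DecidableEq V] {G : SimpleGraph V} [DecidableRel G.Adj]
  {T : ℕ} {α β : PMF (Finset V)} {ε : ℝ} {q₀ : V → ℕ} {Ω : Type w} [MeasurableSpace Ω]
  {P : Measure Ω} [IsProbabilityMeasure P] {A σ : ℕ → Ω → Finset V}

theorem sqrt_sum_sq_le (Q : V → ℕ) :
    Real.sqrt (∑ v, h (Q v) ^ 2) ≤ Fintype.card V * h (maxQueue Q) := by
  have hn : ∀ v, 0 ≤ h (Q v) := fun v => h_nonneg (Nat.cast_nonneg _)
  have h1 : Real.sqrt (∑ v, h (Q v) ^ 2) ≤ ∑ v, h (Q v) :=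
    Real.sqrt_le_iff.2 ⟨Finset.sum_nonneg fun v _ => hn v,
      Finset.sum_sq_le_sq_sum_of_nonneg fun v _ => hn v⟩
  refine h1.trans ?_
  calc ∑ v, h (Q v) ≤ ∑ _v : V, h (maxQueue Q) := Finset.sum_le_sum fun v _ =>
        h_mono (Nat.cast_nonneg _) (by exact_mod_cast le_maxQueue Q v)
    _ = _ := by rw [Finset.sum_const, Finset.card_univ, nsmul_eq_mul]

theorem IsDelayedCSMA.queueStable_of_sum_le (H : IsDelayedCSMA G T α β ε q₀ P A σ) {B C : ℝ}
    (hB : 0 ≤ B)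
    (hle : ∀ K : ℕ, ∑ t ∈ Finset.range K,
      ∫ ω, h (maxQueue (queue q₀ (fun i => A i ω) (fun i => σ i ω) t)) ∂P ≤ B + C * K) :
    QueueStable P (fun t ω => queue q₀ (fun i => A i ω) (fun i => σ i ω) t) := by
  set N : ℝ := (Fintype.card V : ℝ)
  have hN : 0 ≤ N := Nat.cast_nonneg _
  have hint : ∀ t, ∫⁻ ω, ENNReal.ofReal (Real.sqrt (∑ v : V,
      h (queue q₀ (fun i => A i ω) (fun i => σ i ω) t v) ^ 2)) ∂P ≤
      ENNReal.ofReal (N * ∫ ω, h (maxQueue (queue q₀ (fun i => A i ω) (fun i => σ i ω) t)) ∂P) := by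
    intro t
    have hi : Integrable (fun ω => N * h (maxQueue (queue q₀ (fun i => A i ω) (fun i => σ i ω) t)))
        P := (H.integrable (dependsUpTo_maxQueue t)).const_mul N
    rw [← integral_const_mul, ofReal_integral_eq_lintegral_ofReal hi
      (Eventually.of_forall fun ω => mul_nonneg hN (h_nonneg (Nat.cast_nonneg _)))]
    exact lintegral_mono fun ω => ENNReal.ofReal_le_ofReal (sqrt_sum_sq_le _)
  refine lt_of_le_of_lt (limsup_le_of_le (a := ENNReal.ofReal (N * (B + C))) (h := ?_))
    ENNReal.ofReal_lt_top
  filter_upwards [eventually_ge_atTop 1] with K hK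
  have hK1 : (1 : ℝ) ≤ K := by exact_mod_cast hK
  have hK0 : (K : ℝ≥0∞) ≠ 0 := by exact_mod_cast (by omega : K ≠ 0)
  rw [ENNReal.inv_mul_le_iff hK0 (ENNReal.natCast_ne_top K)]
  calc _ ≤ ∑ t ∈ Finset.range K, ENNReal.ofReal
        (N * ∫ ω, h (maxQueue (queue q₀ (fun i => A i ω) (fun i => σ i ω) t)) ∂P) :=
        Finset.sum_le_sum fun t _ => hint t
    _ = ENNReal.ofReal (N * ∑ t ∈ Finset.range K,
        ∫ ω, h (maxQueue (queue q₀ (fun i => A i ω) (fun i => σ i ω) t)) ∂P) := by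
        rw [Finset.mul_sum, ENNReal.ofReal_sum_of_nonneg]
        exact fun t _ => mul_nonneg hN (integral_nonneg fun ω => h_nonneg (Nat.cast_nonneg _))
    _ ≤ ENNReal.ofReal (K * (N * (B + C))) := by
        refine ENNReal.ofReal_le_ofReal ?_
        have h1 := mul_le_mul_of_nonneg_left (hle K) hN
        have h2 : N * (B + C * K) ≤ N * (K * (B + C)) :=
          mul_le_mul_of_nonneg_left (by nlinarith) hN
        linarith
    _ = _ := by rw [ENNReal.ofReal_mul (by positivity), ENNReal.ofReal_natCast]

theorem stabilizes_of_le_one [Nonempty V] (hα : IsDecisionLaw G α) (hT : 1 ≤ T) (hε : 0 < ε)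
    (hε1 : ε ≤ 1) {η : V → ℝ} (hη : η ∈ (1 - ε) • capacityRegion G) :
    Stabilizes.{u, w} G T α ε η := by
  intro β hβ q₀ Ω _ P _ A σ H
  obtain ⟨g, C, hg, hlip⟩ := exists_corrector hα hε hε1
  have hC : 0 ≤ C := (abs_nonneg _).trans (hlip 0 0 ∅ (fun v => by simp) fun v => by simp)
  obtain ⟨k, rfl⟩ : ∃ k, T = k + 1 := ⟨T - 1, by omega⟩
  set R : ℝ := 2 ^ Fintype.card V + (k + 1) * C + Fintype.card V with hR
  have hR0 : 0 ≤ R := by positivity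
  set X : ℕ → ℝ := fun t =>
    ∫ ω, h (maxQueue (queue q₀ (fun i => A i ω) (fun i => σ i ω) t)) ∂P with hX
  set U : ℕ → ℝ := fun t =>
    ∫ ω, lyapunov (k + 1) g q₀ t (fun i => A i ω) (fun i => σ i ω) ∂P with hU
  have hX0 : ∀ t, 0 ≤ X t := fun t => integral_nonneg fun ω => h_nonneg (Nat.cast_nonneg _)
  have hiX : ∀ t, Integrable
      (fun ω => h (maxQueue (queue q₀ (fun i => A i ω) (fun i => σ i ω) t))) P := fun t =>
    H.integrable (dependsUpTo_maxQueue t)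
  have hiU : ∀ t, Integrable
      (fun ω => lyapunov (k + 1) g q₀ t (fun i => A i ω) (fun i => σ i ω)) P := fun t =>
    H.integrable (dependsUpTo_lyapunov g t)
  -- For `t ≥ k` slot `t + 1` is past the initial idle period and `t - k` is not truncated, so the
  -- new schedule comes from the Glauber kernel.
  have step : ∀ t, k ≤ t → U (t + 1) - U t + ε / 2 * X t - R ≤ 0 := by
    intro t hkt
    have hdep : DependsUpTo (t + 1) fun a s => lyapunov (k + 1) g q₀ (t + 1) a s -
        lyapunov (k + 1) g q₀ t a s + ε / 2 * h (maxQueue (queue q₀ a s t)) - R := by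
      intro a a' s s' ha hs
      have ha' : ∀ i, 1 ≤ i → i ≤ t → a i = a' i := fun i h1 h2 => ha i h1 (h2.trans t.le_succ)
      have hs' : ∀ i ≤ t, s i = s' i := fun i h => hs i (h.trans t.le_succ)
      simp only [dependsUpTo_lyapunov g (t + 1) a a' s s' ha hs,
        dependsUpTo_lyapunov g t a a' s s' ha' hs', queue_congr t ha' hs']
    have hint := H.integral_nonpos hT hdep fun a s => ?_
    · have i1 : Integrable (fun ω => lyapunov (k + 1) g q₀ (t + 1) (fun i => A i ω) (fun i => σ i ω) -
          lyapunov (k + 1) g q₀ t (fun i => A i ω) (fun i => σ i ω)) P := (hiU (t + 1)).sub (hiU t)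
      have i2 : Integrable (fun ω => ε / 2 *
          h (maxQueue (queue q₀ (fun i => A i ω) (fun i => σ i ω) t))) P := (hiX t).const_mul _
      have i3 := i1.add i2
      simp only [Pi.add_def] at i3
      rw [integral_sub i3 (integrable_const _), integral_add i1 i2,
        integral_sub (hiU (t + 1)) (hiU t), integral_const_mul, integral_const] at hint
      simpa using hint
    · set Q := queue q₀ a s t with hQ
      have hq : ∀ y b : Finset V, queue q₀ (Function.update a (t + 1) b)
          (Function.update s (t + 1) y) t = Q := fun y b =>
        queue_congr t (fun i _ hi => by rw [Function.update_of_ne (by omega)])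
          fun i hi => by rw [Function.update_of_ne (by omega)]
      have hfug : ∀ v, 0 ≤ fugacity ε Q v := fun v => (Real.exp_pos _).le
      have hprob : ∀ y, scheduleProb G (k + 1) α ε q₀ a s t y =
          glauber G α (fugacity ε Q) (s (t - k)) y := fun y => by
        rw [scheduleProb, if_neg (by omega), Nat.add_sub_add_right]
      have hdrift := conditional_drift_le (α := α) hε hε1 hη hβ Q (s (t - k)) (hg Q (s (t - k)))
      have hone : ∑ y, ∑ b, glauber G α (fugacity ε Q) (s (t - k)) y * (β b).toReal = 1 := by
        simp_rw [← Finset.mul_sum, pmf_sum_toReal, mul_one]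
        exact glauber_row_sum hfug _
      set c := g Q (s (t - k)) + (k + 1) * C + Fintype.card V + ε / 2 * h (maxQueue Q) - R with hc
      calc _ ≤ ∑ y, ∑ b, glauber G α (fugacity ε Q) (s (t - k)) y * (β b).toReal *
            (((-(∑ v ∈ y, h (Q v)) - g Q y) + ∑ v, h (Q v) * (if v ∈ b then 1 else 0)) + c) := by
            refine Finset.sum_le_sum fun y _ => Finset.sum_le_sum fun b _ => ?_
            rw [hprob]
            refine mul_le_mul_of_nonneg_left ?_
              (mul_nonneg (glauber_nonneg hfug _ _) ENNReal.toReal_nonneg)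
            have h1 := lyapunov_succ_sub_le (q₀ := q₀) k hlip (Function.update a (t + 1) b)
              (Function.update s (t + 1) y) t
            rw [Function.update_self, Function.update_self,
              Function.update_of_ne (by omega : t - k ≠ t + 1), hq] at h1
            rw [hq]
            linarith
        _ = ∑ y, ∑ b, glauber G α (fugacity ε Q) (s (t - k)) y * (β b).toReal *
            ((-(∑ v ∈ y, h (Q v)) - g Q y) + ∑ v, h (Q v) * (if v ∈ b then 1 else 0)) + c := by
            simp_rw [mul_add _ _ c, Finset.sum_add_distrib, ← Finset.sum_mul]
            rw [hone, one_mul]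
        _ ≤ 0 := by linarith
  set E : ℝ := ∑ y, |g q₀ y|
  have hE : 0 ≤ E := Finset.sum_nonneg fun y _ => abs_nonneg _
  have hUlow : ∀ t : ℕ, -((k + 1) * (E + C * t)) ≤ U t := by
    intro t
    have h1 : ∫ _ω, -((k + 1) * (E + C * t)) ∂P ≤ U t :=
      integral_mono (integrable_const _) (hiU t) fun ω => by
        have := neg_le_lyapunov (T := k + 1) (q₀ := q₀) hlip (fun i => A i ω) (fun i => σ i ω) t
        push_cast at this
        exact this
    simpa using h1
  have htel : ∀ n : ℕ, ε / 2 * ∑ t ∈ Finset.range (k + n), X t ≤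
      ε / 2 * ∑ t ∈ Finset.range k, X t + U k - U (k + n) + R * n := by
    intro n
    induction n with
    | zero => simp
    | succ n ih =>
      have h1 := step (k + n) (by omega)
      rw [← add_assoc, Finset.sum_range_succ]
      push_cast
      linarith
  have hall : ∀ K : ℕ, ε / 2 * ∑ t ∈ Finset.range K, X t ≤
      (ε / 2 * ∑ t ∈ Finset.range k, X t + |U k| + (k + 1) * (E + C * k)) +
        ((k + 1) * C + R) * K := by
    intro K
    -- Telescoping starts at `k`; nonnegativity of `X` allows lengthening the sum to fit.
    have h1 : ∑ t ∈ Finset.range K, X t ≤ ∑ t ∈ Finset.range (k + K), X t :=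
      Finset.sum_le_sum_of_subset_of_nonneg (Finset.range_mono (by omega)) fun t _ _ => hX0 t
    have h2 := mul_le_mul_of_nonneg_left h1 (by positivity : 0 ≤ ε / 2)
    have h3 := htel K
    have h4 := hUlow (k + K)
    have h5 := le_abs_self (U k)
    push_cast at h4
    linarith
  refine H.queueStable_of_sum_le
    (B := 2 / ε * (ε / 2 * ∑ t ∈ Finset.range k, X t + |U k| + (k + 1) * (E + C * k)))
    (C := 2 / ε * ((k + 1) * C + R)) ?_ fun K => ?_
  · have := Finset.sum_nonneg fun t (_ : t ∈ Finset.range k) => hX0 t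
    positivity
  · have h1 := mul_le_mul_of_nonneg_left (hall K) (by positivity : 0 ≤ 2 / ε)
    rw [← mul_assoc, div_mul_div_comm, mul_comm 2 ε, div_self (by positivity), one_mul] at h1
    refine h1.trans_eq ?_
    ring

/-- Every nonempty arrival set has probability zero, so the largest queue never grows. This serves
`ε > 1`, where the bounds on weights and rates used above fail. -/
theorem stabilizes_of_nonpos [Nonempty V] (hT : 1 ≤ T) {η : V → ℝ} (hη : ∀ v, η v ≤ 0) :
    Stabilizes.{u, w} G T α ε η := by
  intro β hβ q₀ Ω _ P _ A σ H
  have hb : ∀ b, b ≠ ∅ → (β b).toReal = 0 := by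
    intro b hb
    obtain ⟨v, hv⟩ := Finset.nonempty_iff_ne_empty.2 hb
    have h1 : (if v ∈ b then (β b).toReal else 0) ≤ η v := by
      rw [← hβ v]
      refine Finset.single_le_sum (f := fun b => if v ∈ b then (β b).toReal else 0) (fun b _ => ?_)
        (Finset.mem_univ b)
      split_ifs
      · exact ENNReal.toReal_nonneg
      · exact le_rfl
    rw [if_pos hv] at h1
    exact le_antisymm (h1.trans (hη v)) ENNReal.toReal_nonneg
  have hsp : ∀ (a s : ℕ → Finset V) t y, 0 ≤ scheduleProb G T α ε q₀ a s t y := by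
    intro a s t y
    unfold scheduleProb
    split_ifs
    · exact zero_le_one
    · exact le_rfl
    · exact glauber_nonneg (fun v => (Real.exp_pos _).le) _ _
  set X : ℕ → ℝ := fun t =>
    ∫ ω, h (maxQueue (queue q₀ (fun i => A i ω) (fun i => σ i ω) t)) ∂P with hX
  have hiX : ∀ t, Integrable
      (fun ω => h (maxQueue (queue q₀ (fun i => A i ω) (fun i => σ i ω) t))) P := fun t =>
    H.integrable (dependsUpTo_maxQueue t)
  have step : ∀ t, X (t + 1) ≤ X t := by
    intro t
    have hdep : DependsUpTo (t + 1) fun a s => h (maxQueue (queue q₀ a s (t + 1))) -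
        h (maxQueue (queue q₀ a s t)) := by
      intro a a' s s' ha hs
      simp only [queue_congr (t + 1) ha hs, queue_congr t
        (fun i h1 h2 => ha i h1 (h2.trans t.le_succ)) fun i h => hs i (h.trans t.le_succ)]
    have hint := H.integral_nonpos hT hdep fun a s => ?_
    · rw [integral_sub (hiX (t + 1)) (hiX t)] at hint
      exact sub_nonpos.1 hint
    · refine Finset.sum_nonpos fun y _ => Finset.sum_nonpos fun b _ => ?_
      by_cases hbe : b = ∅
      · refine mul_nonpos_of_nonneg_of_nonpos (mul_nonneg (hsp _ _ _ _) ENNReal.toReal_nonneg) ?_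
        refine sub_nonpos.2 (h_mono (Nat.cast_nonneg _) (Nat.cast_le.2 ?_))
        refine Finset.sup_le fun v _ => le_trans ?_ (le_maxQueue _ v)
        simp [queue, hbe]
      · rw [hb b hbe, mul_zero, zero_mul]
  have hX0 : ∀ t, X t ≤ X 0 := fun t => by
    induction t with
    | zero => exact le_rfl
    | succ t ih => exact (step t).trans ih
  refine H.queueStable_of_sum_le (B := 0) (C := X 0) le_rfl fun K => ?_
  refine (Finset.sum_le_sum fun t _ => hX0 t).trans_eq ?_
  rw [Finset.sum_const, Finset.card_range, nsmul_eq_mul]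
  ring

theorem stabilizes_of_isEmpty [IsEmpty V] (η : V → ℝ) : Stabilizes.{u, w} G T α ε η := by
  intro β _ q₀ Ω _ P _ A σ _
  simp [QueueStable]

theorem capacityRegion_nonneg {ζ : V → ℝ} (hζ : ζ ∈ capacityRegion G) (v : V) : 0 ≤ ζ v := by
  have : capacityRegion G ⊆ Set.Ici 0 := by
    refine convexHull_min ?_ (convex_Ici 0)
    rintro _ ⟨S, -, rfl⟩ v
    simp only [scheduleVector, Pi.zero_apply]
    split_ifs
    · exact zero_le_one
    · exact le_rfl
  exact this hζ v

theorem stabilizes_of_mem (hα : IsDecisionLaw G α) (hT : 1 ≤ T) (hε : 0 < ε) {η : V → ℝ}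
    (hη : η ∈ (1 - ε) • capacityRegion G) : Stabilizes.{u, w} G T α ε η := by
  rcases isEmpty_or_nonempty V with hV | hV
  · exact stabilizes_of_isEmpty η
  rcases le_or_gt ε 1 with h1 | h1
  · exact stabilizes_of_le_one hα hT hε h1 hη
  · obtain ⟨ζ, hζ, rfl⟩ := hη
    exact stabilizes_of_nonpos hT fun v =>
      mul_nonpos_of_nonpos_of_nonneg (by linarith) (capacityRegion_nonneg hζ v)

/-- The capacity region is convex and contains 0, the vector of the empty schedule. -/
theorem smul_capacityRegion_subset {ρ r : ℝ} (hρ : 0 ≤ ρ) (hr : ρ ≤ r) :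
    ρ • capacityRegion G ⊆ r • capacityRegion G := by
  rintro _ ⟨ζ, hζ, rfl⟩
  rcases hρ.eq_or_lt with rfl | hρ
  · rcases hr.eq_or_lt with rfl | hr
    · exact ⟨ζ, hζ, rfl⟩
    · exact ⟨0, subset_convexHull ℝ _ ⟨∅, feasible_empty G, by ext; simp [scheduleVector]⟩,
        by simp⟩
  · have h0 : (0 : V → ℝ) ∈ capacityRegion G :=
      subset_convexHull ℝ _ ⟨∅, feasible_empty G, by ext; simp [scheduleVector]⟩
    have hr0 : 0 < r := hρ.trans_le hr
    refine ⟨(ρ / r) • ζ, (convex_convexHull ℝ _).smul_mem_of_zero_mem h0 hζ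
      ⟨by positivity, (div_le_one hr0).2 hr⟩, ?_⟩
    change r • (ρ / r) • ζ = ρ • ζ
    rw [smul_smul, mul_div_cancel₀ _ hr0.ne']

end Stability

end DelayedCSMA

end

theorem proposition4 {V : Type u} [Fintype V] [DecidableEq V]
    (G : SimpleGraph V) [DecidableRel G.Adj]
    (α : PMF (Finset V)) (hα : DelayedCSMA.IsDecisionLaw G α)
    (T : ℕ) (hT : 1 ≤ T) :
    (∀ ε : ℝ, 0 < ε → ∀ η ∈ (1 - ε) • DelayedCSMA.capacityRegion G,
      DelayedCSMA.Stabilizes.{u, w} G T α ε η) ∧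
    DelayedCSMA.ThroughputOptimal.{u, w} G T α := by
  refine ⟨fun ε hε η hη => DelayedCSMA.stabilizes_of_mem hα hT hε hη, ?_⟩
  rintro η ⟨ρ, hρ0, hρ1, hη⟩
  -- The threshold `1 - ρ` is what gives `ρ ≤ 1 - ε`.
  exact ⟨1 - ρ, by linarith, fun ε hε hle => DelayedCSMA.stabilizes_of_mem hα hT hε
    (DelayedCSMA.smul_capacityRegion_subset hρ0 (by linarith) hη)⟩
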